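/- Let $J\subset\mathbb{R}$ be open and let $\tilde\gamma:J\times S^1\to\mathbb{R}^3$, $S^1=\mathbb{R}/2\pi\mathbb{Z}$, be a smooth family of closed immersed curves (so $\tilde\gamma'\ne 0$, where $'=\partial_x$) solving the rescaled curve shortening flow $$\partial_\tau\tilde\gamma=\tfrac12\tilde\gamma+\frac{\tilde\gamma'\times(\tilde\gamma''\times\tilde\gamma')}{|\tilde\gamma'|^4}=\tfrac12\tilde\gamma+\kappa\nu,$$ where $\kappa=\frac{|\tilde\gamma''\times\tilde\gamma'|}{|\tilde\gamma'|^3}$ is the curvature and $\nu=\frac{\tilde\gamma'\times(\tilde\gamma''\times\tilde\gamma')}{|\tilde\gamma'|\,|\tilde\gamma''\times\tilde\gamma'|}$ the principal normal. Put $\psi=\arcsin\frac{\langle\tilde\gamma,\tilde\gamma'\rangle}{|\tilde\gamma||\tilde\gamma'|}\in[-\frac\pi2,\frac\pi2]$. (1) At every time $\tau\in J$ at which the curve does not pass through the origin, the length $\int_{S^1}\frac{|\tilde\gamma'|}{|\tilde\gamma|}\cos\psi\,dx$ of the radial projection of the curve to the unit sphere is differentiable in $\tau$, and $$\frac{d}{d\tau}\int_{S^1}\frac{|\tilde\gamma'|}{|\tilde\gamma|}\cos\psi\,dx=-\int_{S^1}\frac{|\tilde\gamma'|}{|\tilde\gamma|^3\cos^3\psi}\,\kappa^2\,\big|\mathrm{Proj}_{\nu\times\tilde\gamma'}\tilde\gamma\big|^2\,dx-2\sum_{\psi(x)=\pm\frac\pi2}\frac{\kappa(x)}{|\tilde\gamma(x)|},$$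 where $\mathrm{Proj}_v$ is the orthogonal projection onto the line spanned by $v$, the sum is over the points $x\in S^1$ with $\psi(x)=\pm\frac\pi2$ (that is, $\tilde\gamma\parallel\tilde\gamma'$), and the integrand on the right is taken to be $0$ where $\kappa=0$ or $\cos\psi=0$. Both integrals converge, and so does the sum. (2) For every continuous $a:[0,\infty)\to\mathbb{R}$ and every $\tau\in J$, $$\int_{S^1}a(|\tilde\gamma|)\,|\tilde\gamma'|\sin\psi\,dx=0,$$ where the integrand is taken to be $0$ at the (at most finitely many) points with $\tilde\gamma=0$. -/

import Mathlib

open Real Set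
open scoped ContDiff Matrix

noncomputable section

/-- Euclidean three-space. -/
abbrev E3 : Type := EuclideanSpace ℝ (Fin 3)

/-- The cross product on Euclidean three-space. -/
def cross (u v : E3) : E3 := WithLp.toLp 2 (u.ofLp ⨯₃ v.ofLp)

/-- The curvature `κ = |c'' × c'| / |c'|³` of a parametrized curve. -/
def curvature (c : ℝ → E3) (x : ℝ) : ℝ :=
  ‖cross (deriv (deriv c) x) (deriv c x)‖ / ‖deriv c x‖ ^ 3

/-- The principal normal `ν = c' × (c'' × c') / (|c'| |c'' × c'|)`
(the zero vector where the curvature vanishes). -/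
def unitNormal (c : ℝ → E3) (x : ℝ) : E3 :=
  (‖deriv c x‖ * ‖cross (deriv (deriv c) x) (deriv c x)‖)⁻¹ •
    cross (deriv c x) (cross (deriv (deriv c) x) (deriv c x))

/-- The curvature vector `κν = c' × (c'' × c') / |c'|⁴`. -/
def curvatureVector (c : ℝ → E3) (x : ℝ) : E3 :=
  (‖deriv c x‖ ^ 4)⁻¹ • cross (deriv c x) (cross (deriv (deriv c) x) (deriv c x))

/-- The signed angle in `[-π/2, π/2]` between the position vector and the plane orthogonal
to the tangent vector. -/
def psi (c : ℝ → E3) (x : ℝ) : ℝ :=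
  arcsin (inner ℝ (c x) (deriv c x) / (‖c x‖ * ‖deriv c x‖))

/-- Orthogonal projection of `w` onto the line spanned by `v`. -/
def projLine (v w : E3) : E3 := (Submodule.span ℝ {v}).starProjection w

/-- A smooth solution, for times in `J`, of the rescaled curve shortening flow of closed immersed
curves in three-space. The circle `S¹` is `ℝ / 2πℤ`: maps on it are `2π`-periodic maps on `ℝ`. -/
structure IsRescaledCSF (J : Set ℝ) (γ : ℝ → ℝ → E3) : Prop where
  smooth : ContDiffOn ℝ ∞ (fun p : ℝ × ℝ => γ p.1 p.2) (J ×ˢ univ)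
  periodic : ∀ τ ∈ J, Function.Periodic (γ τ) (2 * π)
  immersed : ∀ τ ∈ J, ∀ x, deriv (γ τ) x ≠ 0
  flow : ∀ τ ∈ J, ∀ x,
    HasDerivAt (fun s => γ s x) ((1 / 2 : ℝ) • γ τ x + curvatureVector (γ τ) x) τ

/-- The integrand `|c'| / |c| * cos ψ` of the length of the radial projection to the sphere. -/
def sphereLengthDensity (c : ℝ → E3) (x : ℝ) : ℝ :=
  ‖deriv c x‖ / ‖c x‖ * cos (psi c x)

/-- The integrand `|c'| / (|c|³ cos³ ψ) * κ² * |Proj_{ν × c'} c|²` (zero where `cos ψ = 0`). -/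
def dissipationDensity (c : ℝ → E3) (x : ℝ) : ℝ :=
  ‖deriv c x‖ / (‖c x‖ ^ 3 * cos (psi c x) ^ 3) * curvature c x ^ 2 *
    ‖projLine (cross (unitNormal c x) (deriv c x)) (c x)‖ ^ 2

/-- The points of the circle (represented in `[0, 2π)`) with `ψ = ±π/2`. -/
def radialPoints (c : ℝ → E3) : Set ℝ :=
  {x | x ∈ Ico 0 (2 * π) ∧ (psi c x = π / 2 ∨ psi c x = -(π / 2))}

end

open Filter Topology MeasureTheory

/-! Write c for the curve at a fixed time, V for its curvature vector, w = c × c', W = |w|. Since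
cos ψ = W / (|c||c'|), the length density is W / |c|², and the points with ψ = ±π/2 are the zeros of
w. The term ½c only rescales c, so it does not move the radial projection and only V contributes to
the rate g of the density.

Where w ≠ 0, a scalar computation gives F' = D + g, with D ≥ 0 the dissipation density and F = ⟨B,
w⟩ / W a boundary flux (`hasDerivAt_flux`). The field B is chosen so that w' is a positive multiple
of B at the zeros of w. Hence at a zero where B ≠ 0 the unit vector w / W flips from -B/|B| to
B/|B|, and F jumps by 2|B| = 2κ/|c|. Periodicity makes the integral of D + g plus all the jumps
vanish, which is the formula.

Zeros where also B = 0 may be infinite in number. They are removed by the cutoff φ((|B|² + |w|²)/δ).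
The product of F with the derivative of the cutoff stays bounded as δ → 0, because |F| and the
derivative of |B|² + |w|² are, respectively, at most √s and a bounded multiple of √s, where s = |B|²
+ |w|² ≤ 2δ on the support. As D and the jumps are nonnegative, this bound yields their
integrability and summability, and dominated convergence gives the identity
(`JumpData.integral_eq`).

Differentiation under the time integral needs the norm W / |c|² to be Lipschitz in time and
differentiable for almost every x. It can fail to be differentiable only at zeros of w that move
with nonzero velocity, and these are countable (`countable_setOf_crossRate_ne_zero`).

For (2), the integrand is the derivative of A(|c|) with A' = a, away from the countable zero set of
c. -/

/-! ### Countable exceptional sets and a cutoff function -/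

/-- The isolated points of a subset of the line form a countable set. -/
theorem countable_setOf_not_accPt (S : Set ℝ) : {x ∈ S | ¬ AccPt x (𝓟 S)}.Countable := by
  set T := {x ∈ S | ¬ AccPt x (𝓟 S)} with hT
  have : DiscreteTopology T := by
    rw [discreteTopology_subtype_iff]
    rintro x ⟨-, hx⟩
    rw [AccPt, not_neBot] at hx
    refine le_bot_iff.1 (le_trans ?_ hx.le)
    exact inf_le_inf_left _ (principal_mono.2 fun y hy => hy.1)
  have : Countable T := countable_of_Lindelof_of_discrete
  exact this.to_set

/-- A differentiable function has zero derivative at all but countably many points of its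
zero set. -/
theorem countable_setOf_eq_zero_of_deriv_ne_zero {E : Type*} [NormedAddCommGroup E]
    [NormedSpace ℝ E] {f f' : ℝ → E} (S : Set ℝ) (hf : ∀ x, HasDerivAt f (f' x) x)
    (h0 : ∀ x ∈ S, f x = 0) :
    {x ∈ S | f' x ≠ 0}.Countable := by
  refine (countable_setOf_not_accPt S).mono ?_
  rintro x ⟨hxS, hx⟩
  refine ⟨hxS, fun hacc => ?_⟩
  have h1 := (hf x).eventually_ne (c := 0) hx
  have h2 : ∀ᶠ z in 𝓝[≠] x ⊓ 𝓟 S, f z ≠ 0 := h1.filter_mono inf_le_left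
  have h3 : ∀ᶠ z in 𝓝[≠] x ⊓ 𝓟 S, z ∈ S :=
    (eventually_principal.2 fun z hz => hz).filter_mono inf_le_right
  have : NeBot (𝓝[≠] x ⊓ 𝓟 S) := hacc
  obtain ⟨z, hz1, hz2⟩ := (h2.and h3).exists
  exact hz1 (h0 z hz2)

/-- A `C¹` cutoff function on the line. -/
theorem exists_cutoff : ∃ φ φ' : ℝ → ℝ, ∃ M : ℝ, 0 ≤ M ∧ (∀ t, HasDerivAt φ (φ' t) t) ∧
    Continuous φ' ∧ (∀ t, t ≤ 1 → φ t = 0) ∧ (∀ t, 2 ≤ t → φ t = 1) ∧ (∀ t, 0 ≤ φ t) ∧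
    (∀ t, φ t ≤ 1) ∧ (∀ t, |φ' t| ≤ M) ∧ (∀ t, t ≤ 1 → φ' t = 0) ∧ (∀ t, 2 ≤ t → φ' t = 0) := by
  set φ : ℝ → ℝ := fun t => smoothTransition (t - 1) with hφ
  have hsm : ContDiff ℝ 1 φ := Real.smoothTransition.contDiff.comp (contDiff_id.sub contDiff_const)
  have hc : Continuous (deriv φ) := hsm.continuous_deriv le_rfl
  have h1 : ∀ t, t ≤ 1 → φ t = 0 := fun t ht =>
    smoothTransition.zero_of_nonpos (by linarith)
  have h2 : ∀ t, 2 ≤ t → φ t = 1 := fun t ht => smoothTransition.one_of_one_le (by linarith)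
  have h3 : ∀ t, 0 ≤ φ t := fun t => smoothTransition.nonneg _
  have h4 : ∀ t, φ t ≤ 1 := fun t => smoothTransition.le_one _
  have h5 : ∀ t, t ≤ 1 → deriv φ t = 0 := fun t ht =>
    IsLocalMin.deriv_eq_zero (Eventually.of_forall fun s => by rw [h1 t ht]; exact h3 s)
  have h6 : ∀ t, 2 ≤ t → deriv φ t = 0 := fun t ht =>
    IsLocalMax.deriv_eq_zero (Eventually.of_forall fun s => by rw [h2 t ht]; exact h4 s)
  obtain ⟨M, hM⟩ := (isCompact_Icc (a := (1:ℝ)) (b := 2)).exists_bound_of_continuousOn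
    hc.continuousOn
  have hM0 : 0 ≤ M := (norm_nonneg _).trans (hM 1 (by norm_num))
  refine ⟨φ, deriv φ, M, hM0, fun t => (hsm.differentiable one_ne_zero t).hasDerivAt, hc, h1, h2,
    h3, h4, fun t => ?_, h5, h6⟩
  rcases le_total t 1 with ht | ht
  · rw [h5 t ht]; simpa
  rcases le_total t 2 with ht' | ht'
  · exact hM t ⟨ht, ht'⟩
  · rw [h6 t ht']; simpa

theorem intervalIntegrable_of_le_continuous {f G : ℝ → ℝ} (hf : Measurable f) (hG : Continuous G)
    (hfG : ∀ x, |f x| ≤ G x) (a b : ℝ) : IntervalIntegrable f volume a b :=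
  (hG.intervalIntegrable a b).mono_fun hf.aestronglyMeasurable
    (Eventually.of_forall fun x => by
      exact (hfG x).trans (le_abs_self (G x)))

/-! ### Sign flip of a vector field at a nondegenerate zero -/

section Jump

variable {E : Type*} [NormedAddCommGroup E] [InnerProductSpace ℝ E]

/-- At a nondegenerate zero `p` of `w`, the component of `B` along `w` jumps by `2‖B p‖`. -/
theorem continuousAt_inner_unit_sub_sign {w B : ℝ → E} {ψ : ℝ → ℝ} {p μ : ℝ}
    (hw : HasDerivAt w (μ • B p) p) (hwp : w p = 0) (hB : ContinuousAt B p)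
    (hψ : ContinuousAt ψ p) (hμ : 0 < μ) (hBp : B p ≠ 0) :
    ContinuousAt (fun x => ψ x * (inner ℝ (B x) (w x) / ‖w x‖) -
      ψ p * ‖B p‖ * SignType.sign (x - p)) p := by
  have hv : ContinuousAt (dslope w p) p := by
    rw [continuousAt_dslope_same]; exact hw.differentiableAt
  have hvp : dslope w p p = μ • B p := by rw [dslope_same, hw.deriv]
  have hvp0 : ‖dslope w p p‖ ≠ 0 := by
    rw [hvp, norm_smul]; simp [hμ.ne', hBp]
  -- Near p, w = (x - p) v with v = `dslope w p` continuous and nonzero at p, so the quotient is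
  -- sign(x - p) times the continuous function G.
  set G : ℝ → ℝ := fun x => ψ x * (inner ℝ (B x) (dslope w p x) / ‖dslope w p x‖) with hG
  have hGc : ContinuousAt G p := hψ.mul ((hB.inner hv).div hv.norm hvp0)
  have hGp : G p = ψ p * ‖B p‖ := by
    simp only [hG, hvp, inner_smul_right, real_inner_self_eq_norm_sq, norm_smul, Real.norm_eq_abs,
      abs_of_pos hμ]
    have : ‖B p‖ ≠ 0 := by simpa using hBp
    field_simp
  have hF : ∀ x, ψ x * (inner ℝ (B x) (w x) / ‖w x‖) = SignType.sign (x - p) * G x := by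
    intro x
    have hx : w x = (x - p) • dslope w p x := by
      rw [sub_smul_dslope, hwp, sub_zero]
    rcases lt_trichotomy (x - p) 0 with h | h | h
    · rw [hx, inner_smul_right, norm_smul, Real.norm_eq_abs, abs_of_neg h, sign_neg h]
      simp only [hG, SignType.coe_neg, SignType.coe_one]
      rw [neg_mul (x - p), div_neg, mul_div_mul_left _ _ h.ne]; ring
    · rw [hx, h]; simp
    · rw [hx, inner_smul_right, norm_smul, Real.norm_eq_abs, abs_of_pos h, sign_pos h]
      simp only [hG, SignType.coe_one]
      rw [mul_div_mul_left _ _ h.ne']; ring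
  simp only [hF]
  have h0 : Tendsto (fun x => G x - ψ p * ‖B p‖) (𝓝 p) (𝓝 0) := by
    have := hGc.tendsto.sub_const (ψ p * ‖B p‖)
    rwa [hGp, sub_self] at this
  have key : Tendsto (fun x => (SignType.sign (x - p) : ℝ) * G x -
      ψ p * ‖B p‖ * SignType.sign (x - p)) (𝓝 p) (𝓝 0) := by
    refine squeeze_zero_norm (a := fun x => ‖G x - ψ p * ‖B p‖‖) (fun x => ?_)
      (by simpa using h0.norm)
    rw [show (SignType.sign (x - p) : ℝ) * G x - ψ p * ‖B p‖ * SignType.sign (x - p)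
      = SignType.sign (x - p) * (G x - ψ p * ‖B p‖) by ring, norm_mul]
    have h1 : ‖(SignType.sign (x - p) : ℝ)‖ ≤ 1 := by
      rcases SignType.sign (x - p) with _ | _ | _ <;> simp
    exact mul_le_of_le_one_left (norm_nonneg _) h1
  simpa [ContinuousAt] using key

/-- The nondegenerate zeros in a compact interval on which `‖B‖² + ‖w‖²` stays away from zero are
finitely many. -/
theorem finite_zeros {w B : ℝ → E} {μ : ℝ → ℝ} (hw : ∀ x, w x = 0 → HasDerivAt w (μ x • B x) x)
    (hμ : ∀ x, w x = 0 → 0 < μ x) (hwc : Continuous w) (hB : Continuous B) {δ : ℝ} (hδ : 0 < δ)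
    (a b : ℝ) :
    {x | x ∈ Ico a b ∧ w x = 0 ∧ δ ≤ ‖B x‖ ^ 2 + ‖w x‖ ^ 2}.Finite := by
  have hK : IsCompact {x | x ∈ Icc a b ∧ w x = 0 ∧ δ ≤ ‖B x‖ ^ 2 + ‖w x‖ ^ 2} := by
    refine isCompact_Icc.of_isClosed_subset ?_ fun x hx => hx.1
    exact isClosed_Icc.inter ((isClosed_eq hwc continuous_const).inter
      (isClosed_le continuous_const ((hB.norm.pow 2).add (hwc.norm.pow 2))))
  refine Set.Finite.subset ?_ (t := {x | x ∈ Ico a b ∧ w x = 0 ∧ δ ≤ ‖B x‖ ^ 2 + ‖w x‖ ^ 2})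
    (s := {x | x ∈ Icc a b ∧ w x = 0 ∧ δ ≤ ‖B x‖ ^ 2 + ‖w x‖ ^ 2})
    fun x hx => ⟨Ico_subset_Icc_self hx.1, hx.2⟩
  -- A nonzero derivative isolates each of these zeros; a compact discrete set is finite.
  refine hK.finite ?_
  rw [isDiscrete_iff_discreteTopology, discreteTopology_subtype_iff]
  rintro x ⟨-, hx, hq⟩
  have hBx : B x ≠ 0 := by
    rintro h; rw [h, hx] at hq; norm_num at hq; linarith
  have h1 := (hw x hx).eventually_ne (c := 0) (smul_ne_zero (hμ x hx).ne' hBx)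
  rw [← empty_mem_iff_bot, mem_inf_principal]
  filter_upwards [h1] with z hz hz'
  exact absurd hz'.2.1 hz

end Jump

/-! ### Abstract jump formula: setting, cutoff bounds and step functions -/

set_option linter.unusedSectionVars false

/-- A periodic pair of vector fields `w`, `B`, with `B` a positive multiple of `w'` on the zero set
of `w`, such that the component of `B` along `w` has derivative `D + g` where `w ≠ 0`, with
`D` nonnegative and `g` bounded. -/
structure JumpData {E : Type*} [NormedAddCommGroup E] [InnerProductSpace ℝ E] (T : ℝ)
    (w w' B B' : ℝ → E) (μ D g G : ℝ → ℝ) : Prop where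
  T_pos : 0 < T
  hasDerivAt_w : ∀ x, HasDerivAt w (w' x) x
  hasDerivAt_B : ∀ x, HasDerivAt B (B' x) x
  continuous_w' : Continuous w'
  continuous_B' : Continuous B'
  periodic_w : Function.Periodic w T
  periodic_B : Function.Periodic B T
  deriv_eq : ∀ x, w x = 0 → w' x = μ x • B x
  mu_pos : ∀ x, w x = 0 → 0 < μ x
  D_nonneg : ∀ x, 0 ≤ D x
  D_zero : ∀ x, w x = 0 → D x = 0
  continuousAt_D : ∀ x, w x ≠ 0 ∨ B x ≠ 0 → ContinuousAt D x
  measurable_g : Measurable g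
  abs_g_le : ∀ x, |g x| ≤ G x
  continuous_G : Continuous G
  g_zero : ∀ x, w x = 0 → g x = 0
  hasDerivAt_F : ∀ x, w x ≠ 0 → HasDerivAt (fun y => inner ℝ (B y) (w y) / ‖w y‖) (D x + g x) x

namespace JumpData

variable {E : Type*} [NormedAddCommGroup E] [InnerProductSpace ℝ E] {T : ℝ}
    {w w' B B' : ℝ → E} {μ D g G : ℝ → ℝ}

theorem continuous_w (h : JumpData T w w' B B' μ D g G) : Continuous w :=
  continuous_iff_continuousAt.2 fun x => (h.hasDerivAt_w x).continuousAt

theorem continuous_B (h : JumpData T w w' B B' μ D g G) : Continuous B :=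
  continuous_iff_continuousAt.2 fun x => (h.hasDerivAt_B x).continuousAt

/-- The squared size of the pair, which vanishes at the degenerate zeros of `w` only. -/
noncomputable def sz (w B : ℝ → E) (x : ℝ) : ℝ := ‖B x‖ ^ 2 + ‖w x‖ ^ 2

/-- The derivative of `sz`. -/
noncomputable def sz' (w w' B B' : ℝ → E) (x : ℝ) : ℝ :=
  2 * inner ℝ (B x) (B' x) + 2 * inner ℝ (w x) (w' x)

theorem sz_nonneg (w B : ℝ → E) (x : ℝ) : 0 ≤ sz w B x := by unfold sz; positivity

theorem sz_pos {x : ℝ} (hx : w x ≠ 0 ∨ B x ≠ 0) : 0 < sz w B x := by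
  unfold sz
  rcases hx with hx | hx
  · have := norm_pos_iff.2 hx; positivity
  · have := norm_pos_iff.2 hx; positivity

theorem ne_zero_of_sz_pos {x : ℝ} (hx : 0 < sz w B x) : w x ≠ 0 ∨ B x ≠ 0 := by
  by_contra! hc
  simp [sz, hc.1, hc.2] at hx

theorem hasDerivAt_sz (h : JumpData T w w' B B' μ D g G) (x : ℝ) :
    HasDerivAt (sz w B) (sz' w w' B B' x) x :=
  (h.hasDerivAt_B x).norm_sq.add (h.hasDerivAt_w x).norm_sq

theorem continuous_sz (h : JumpData T w w' B B' μ D g G) : Continuous (sz w B) :=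
  (h.continuous_B.norm.pow 2).add (h.continuous_w.norm.pow 2)

theorem continuous_sz' (h : JumpData T w w' B B' μ D g G) : Continuous (sz' w w' B B') :=
  (continuous_const.mul (h.continuous_B.inner h.continuous_B')).add
    (continuous_const.mul (h.continuous_w.inner h.continuous_w'))

/-- The component of `B` along `w`. -/
noncomputable def comp (w B : ℝ → E) (x : ℝ) : ℝ := inner ℝ (B x) (w x) / ‖w x‖

theorem measurable_comp (h : JumpData T w w' B B' μ D g G) : Measurable (comp w B) :=
  (h.continuous_B.inner h.continuous_w).measurable.div h.continuous_w.norm.measurable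

theorem abs_comp_le (w B : ℝ → E) (x : ℝ) : |comp w B x| ≤ ‖B x‖ := by
  unfold comp
  rw [abs_div, abs_norm]
  exact div_le_of_le_mul₀ (norm_nonneg _) (norm_nonneg _) (abs_real_inner_le_norm _ _)

theorem norm_le_sqrt_sz (w B : ℝ → E) (x : ℝ) : ‖B x‖ ≤ √(sz w B x) ∧ ‖w x‖ ≤ √(sz w B x) := by
  constructor <;> apply Real.le_sqrt_of_sq_le <;> unfold sz <;>
    nlinarith [sq_nonneg ‖B x‖, sq_nonneg ‖w x‖]

/-- Both factors are of order √`sz`, so the product is of order `sz`. This is the scaling that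
compensates the factor 1/δ from the cutoff. -/
theorem abs_comp_mul_sz'_le (w w' B B' : ℝ → E) (x : ℝ) :
    |comp w B x * sz' w w' B B' x| ≤ 2 * sz w B x * (‖B' x‖ + ‖w' x‖) := by
  obtain ⟨hB, hw⟩ := norm_le_sqrt_sz w B x
  have h1 : |comp w B x| ≤ √(sz w B x) := (abs_comp_le w B x).trans hB
  have h2 : |sz' w w' B B' x| ≤ 2 * √(sz w B x) * (‖B' x‖ + ‖w' x‖) := by
    unfold sz'
    have a1 := abs_real_inner_le_norm (B x) (B' x)
    have a2 := abs_real_inner_le_norm (w x) (w' x)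
    have b1 := mul_le_mul_of_nonneg_right hB (norm_nonneg (B' x))
    have b2 := mul_le_mul_of_nonneg_right hw (norm_nonneg (w' x))
    calc _ ≤ |2 * inner ℝ (B x) (B' x)| + |2 * inner ℝ (w x) (w' x)| := abs_add_le _ _
      _ = 2 * |inner ℝ (B x) (B' x)| + 2 * |inner ℝ (w x) (w' x)| := by simp [abs_mul]
      _ ≤ _ := by linarith
  rw [abs_mul]
  calc _ ≤ √(sz w B x) * (2 * √(sz w B x) * (‖B' x‖ + ‖w' x‖)) :=
        mul_le_mul h1 h2 (abs_nonneg _) (Real.sqrt_nonneg _)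
    _ = 2 * (√(sz w B x) * √(sz w B x)) * (‖B' x‖ + ‖w' x‖) := by ring
    _ = _ := by rw [Real.mul_self_sqrt (sz_nonneg w B x)]

variable {φ φ' : ℝ → ℝ} {M δ : ℝ}

/-- The error term produced by differentiating the cutoff. -/
noncomputable def err (w w' B B' : ℝ → E) (φ' : ℝ → ℝ) (δ : ℝ) (x : ℝ) : ℝ :=
  comp w B x * (φ' (sz w B x / δ) * (sz' w w' B B' x / δ))

theorem measurable_err (h : JumpData T w w' B B' μ D g G) (hφ' : Continuous φ') (δ : ℝ) :
    Measurable (err w w' B B' φ' δ) :=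
  h.measurable_comp.mul ((hφ'.comp (h.continuous_sz.div_const δ)).mul
    (h.continuous_sz'.div_const δ)).measurable

/-- On the support of φ' one has `sz` ≤ 2δ, which cancels the 1/δ. The bound does not depend on δ
and so serves as a dominating function. -/
theorem abs_err_le (hδ : 0 < δ) (hM : ∀ t, |φ' t| ≤ M) (h2 : ∀ t, 2 ≤ t → φ' t = 0) (x : ℝ) :
    |err w w' B B' φ' δ x| ≤ 4 * M * (‖B' x‖ + ‖w' x‖) := by
  have hM0 : 0 ≤ M := (abs_nonneg _).trans (hM 0)
  unfold err
  rcases le_total 2 (sz w B x / δ) with hq | hq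
  · rw [h2 _ hq]; simp; positivity
  · have hq' : sz w B x ≤ 2 * δ := by rwa [div_le_iff₀ hδ] at hq
    have e : comp w B x * (φ' (sz w B x / δ) * (sz' w w' B B' x / δ))
        = φ' (sz w B x / δ) * ((comp w B x * sz' w w' B B' x) / δ) := by ring
    rw [e, abs_mul, abs_div, abs_of_pos hδ]
    calc _ ≤ M * ((2 * (2 * δ) * (‖B' x‖ + ‖w' x‖)) / δ) := by
          refine mul_le_mul (hM _) ?_ (by positivity) hM0
          gcongr
          exact (abs_comp_mul_sz'_le w w' B B' x).trans (by gcongr)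
      _ = _ := by field_simp; ring

/-- D can be discontinuous only where w and B both vanish, and the cutoff is zero in a neighbourhood
of such points. -/
theorem continuous_cutoff_mul_D (h : JumpData T w w' B B' μ D g G) (hφ : Continuous φ)
    (h1 : ∀ t, t ≤ 1 → φ t = 0) (hδ : 0 < δ) : Continuous fun x => φ (sz w B x / δ) * D x := by
  have hs : Continuous fun x => φ (sz w B x / δ) := hφ.comp (h.continuous_sz.div_const δ)
  rw [continuous_iff_continuousAt]
  intro x
  by_cases hx : w x ≠ 0 ∨ B x ≠ 0
  · exact hs.continuousAt.mul (h.continuousAt_D x hx)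
  · have hq : sz w B x < δ := by
      push Not at hx; simp [sz, hx.1, hx.2, hδ]
    have : (fun x => φ (sz w B x / δ) * D x) =ᶠ[𝓝 x] fun _ => 0 := by
      filter_upwards [h.continuous_sz.continuousAt.eventually_lt continuousAt_const hq] with y hy
      rw [h1 _ ((div_le_one hδ).2 hy.le), zero_mul]
    exact continuousAt_const.congr this.symm

theorem sign_continuousAt {p x : ℝ} (hx : x ≠ p) :
    ContinuousAt (fun y : ℝ => (SignType.sign (y - p) : ℝ)) x := by
  have h1 : ContinuousAt (fun z : ℝ => (SignType.sign z : ℝ)) (x - p) :=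
    (continuous_of_discreteTopology (f := fun s : SignType => (s : ℝ))).continuousAt.comp
      (continuousAt_sign_of_ne_zero (sub_ne_zero.2 hx))
  exact ContinuousAt.comp (f := fun y : ℝ => y - p) h1 (by fun_prop)

theorem sign_hasDerivAt {p x : ℝ} (hx : x ≠ p) :
    HasDerivAt (fun y : ℝ => (SignType.sign (y - p) : ℝ)) 0 x := by
  have : (fun y : ℝ => (SignType.sign (y - p) : ℝ)) =ᶠ[𝓝 x]
      fun _ => (SignType.sign (x - p) : ℝ) := by
    rcases hx.lt_or_gt with hx | hx
    · filter_upwards [Iio_mem_nhds hx] with y hy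
      rw [sign_neg (sub_neg.2 hy), sign_neg (sub_neg.2 hx)]
    · filter_upwards [Ioi_mem_nhds hx] with y hy
      rw [sign_pos (sub_pos.2 hy), sign_pos (sub_pos.2 hx)]
  exact (hasDerivAt_const x _).congr_of_eventuallyEq this

/-- Subtracting the jumps leaves a continuous function. -/
theorem continuousAt_sub_jumps {H f : ℝ → ℝ} (hT : 0 < T) (P : Finset ℝ)
    (hP : ∀ p ∈ P, p ∈ Ico 0 T)
    (hPH : ∀ p ∈ P, ContinuousAt (fun x => H x - f p * SignType.sign (x - p)) p)
    (hHper : Function.Periodic H T)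
    (hPc : ∀ x ∈ Ico 0 T, x ∉ P → ContinuousAt H x) {x : ℝ} (hx : x ∈ Icc 0 T) :
    ContinuousAt (fun x => H x - ∑ p ∈ P,
      f p * (SignType.sign (x - p) + SignType.sign (x - (p + T)))) x := by
  -- The right endpoint T is treated as the translate of 0. The second sign, centred at p + T,
  -- absorbs the jump that H repeats at T when p = 0.
  have main : ∀ x ∈ Ico 0 T, ∀ y, (y = x ∨ (y = x + T ∧ x = 0)) →
      ContinuousAt (fun x => H x - ∑ p ∈ P,
      f p * (SignType.sign (x - p) + SignType.sign (x - (p + T)))) y := by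
    intro x hx y hy
    by_cases hxP : x ∈ P
    · have e : (fun z => H z - ∑ p ∈ P,
          f p * ((SignType.sign (z - p) : ℝ) + SignType.sign (z - (p + T)))) =
          fun z => (H z - f x * ((SignType.sign (z - x) : ℝ) + SignType.sign (z - (x + T)))) -
          ∑ p ∈ P.erase x, f p * ((SignType.sign (z - p) : ℝ) + SignType.sign (z - (p + T))) := by
        ext z
        rw [← Finset.add_sum_erase P _ hxP]; ring
      rw [e]
      refine ContinuousAt.sub ?_ ?_
      · rcases hy with rfl | ⟨rfl, hx0⟩
        · have h1 := (hPH y hxP).sub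
            ((sign_continuousAt (p := y + T) (x := y) (by linarith)).const_mul (f y))
          refine h1.congr (Eventually.of_forall fun z => ?_)
          simp only [Pi.sub_apply]; ring
        · have h0 : ContinuousAt (fun z => H (z - T) - f x * SignType.sign (z - T - x)) (x + T) :=
            ContinuousAt.comp (f := fun z => z - T)
              (g := fun z => H z - f x * (SignType.sign (z - x) : ℝ))
              (by rw [add_sub_cancel_right]; exact hPH x hxP) (by fun_prop)
          have h1 := h0.sub
            ((sign_continuousAt (p := x) (x := x + T) (by linarith)).const_mul (f x))
          refine h1.congr (Eventually.of_forall fun z => ?_)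
          simp only [Pi.sub_apply, hHper.sub_eq z]
          rw [show z - T - x = z - (x + T) by ring]; ring
      · refine tendsto_finsetSum _ fun p hp => ?_
        have hpP := hP p (Finset.mem_of_mem_erase hp)
        have hpx := Finset.ne_of_mem_erase hp
        refine (((sign_continuousAt (p := p) ?_).add (sign_continuousAt (p := p + T) ?_)).const_mul
          (f p)).tendsto
        · rcases hy with rfl | ⟨rfl, hx0⟩
          · exact hpx.symm
          · have := hpP.2; rintro h; linarith
        · rcases hy with rfl | ⟨rfl, hx0⟩
          · have := hpP.1; have := hx.2; rintro h; linarith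
          · rintro h; exact hpx (by linarith)
    · refine ContinuousAt.sub ?_ ?_
      · rcases hy with rfl | ⟨rfl, hx0⟩
        · exact hPc y hx hxP
        · have h0 : ContinuousAt (fun z => H (z - T)) (x + T) :=
            ContinuousAt.comp (f := fun z => z - T) (g := H)
              (by rw [add_sub_cancel_right]; exact hPc x hx hxP) (by fun_prop)
          simpa only [hHper.sub_eq] using h0
      · refine tendsto_finsetSum _ fun p hp => ?_
        have hpP := hP p hp
        have hpx : p ≠ x := fun h => hxP (h ▸ hp)
        refine (((sign_continuousAt (p := p) ?_).add (sign_continuousAt (p := p + T) ?_)).const_mul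
          (f p)).tendsto
        · rcases hy with rfl | ⟨rfl, hx0⟩
          · exact hpx.symm
          · have := hpP.2; rintro h; linarith
        · rcases hy with rfl | ⟨rfl, hx0⟩
          · have := hpP.1; have := hx.2; rintro h; linarith
          · rintro h; exact hpx (by linarith)
  rcases hx.2.lt_or_eq with h | h
  · exact main x ⟨hx.1, h⟩ x (Or.inl rfl)
  · exact main 0 ⟨le_rfl, hT⟩ x (Or.inr ⟨by simp [h], rfl⟩)

/-- Total variation of the sum of the jumps over a period. -/
theorem jumps_sub_jumps {f : ℝ → ℝ} (P : Finset ℝ) (hP : ∀ p ∈ P, p ∈ Ico 0 T) :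
    (∑ p ∈ P, f p * ((SignType.sign (T - p) : ℝ) + SignType.sign (T - (p + T)))) -
      (∑ p ∈ P, f p * ((SignType.sign (0 - p) : ℝ) + SignType.sign (0 - (p + T)))) =
      2 * ∑ p ∈ P, f p := by
  rw [← Finset.sum_sub_distrib, Finset.mul_sum]
  refine Finset.sum_congr rfl fun p hp => ?_
  have h := hP p hp
  -- The two mixed signs are equal and cancel; what remains is 1 - (-1) = 2, also for p = 0.
  rw [show T - (p + T) = 0 - p by ring, sign_pos (sub_pos.2 h.2),
    sign_neg (show 0 - (p + T) < 0 by linarith [h.1, h.2])]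
  simp; ring

end JumpData

/-! ### Abstract jump formula: cut-off identity and passage to the limit -/

namespace JumpData

variable {E : Type*} [NormedAddCommGroup E] [InnerProductSpace ℝ E] {T : ℝ}
    {w w' B B' : ℝ → E} {μ D g G : ℝ → ℝ} {φ φ' : ℝ → ℝ} {M δ : ℝ}

/-- The fundamental theorem of calculus for the component of `B` along `w`, cut off away from the
degenerate zeros of `w`. -/
theorem integral_cutoff (h : JumpData T w w' B B' μ D g G)
    (hφ : ∀ t, HasDerivAt φ (φ' t) t) (hφ' : Continuous φ') (h1 : ∀ t, t ≤ 1 → φ t = 0)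
    (h2 : ∀ t, 2 ≤ t → φ' t = 0) (hφ0 : ∀ t, 0 ≤ φ t) (hφ1 : ∀ t, φ t ≤ 1)
    (hM : ∀ t, |φ' t| ≤ M) (h3 : ∀ t, t ≤ 1 → φ' t = 0) (hδ : 0 < δ) (P : Finset ℝ)
    (hP : ∀ x, x ∈ P ↔ x ∈ Ico 0 T ∧ w x = 0 ∧ δ ≤ sz w B x) :
    (∫ x in 0..T, φ (sz w B x / δ) * D x) + (∫ x in 0..T, φ (sz w B x / δ) * g x) +
      (∫ x in 0..T, err w w' B B' φ' δ x) = -(2 * ∑ p ∈ P, φ (sz w B p / δ) * ‖B p‖) := by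
  have hφc : Continuous φ := continuous_iff_continuousAt.2 fun t => (hφ t).continuousAt
  have hs : Continuous fun x => φ (sz w B x / δ) := hφc.comp (h.continuous_sz.div_const δ)
  have i1 : IntervalIntegrable (fun x => φ (sz w B x / δ) * D x) volume 0 T :=
    (h.continuous_cutoff_mul_D hφc h1 hδ).intervalIntegrable _ _
  have i2 : IntervalIntegrable (fun x => φ (sz w B x / δ) * g x) volume 0 T := by
    refine intervalIntegrable_of_le_continuous (hs.measurable.mul h.measurable_g) h.continuous_G
      (fun x => ?_) _ _
    rw [Pi.mul_apply, abs_mul, abs_of_nonneg (hφ0 _)]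
    exact (mul_le_of_le_one_left (abs_nonneg _) (hφ1 _)).trans (h.abs_g_le x)
  have i3 : IntervalIntegrable (err w w' B B' φ' δ) volume 0 T :=
    intervalIntegrable_of_le_continuous (h.measurable_err hφ' δ)
      (continuous_const.mul (h.continuous_B'.norm.add h.continuous_w'.norm))
      (abs_err_le hδ hM h2) _ _
  set H : ℝ → ℝ := fun x => φ (sz w B x / δ) * comp w B x with hH
  set f : ℝ → ℝ := fun x => φ (sz w B x / δ) * ‖B x‖ with hf
  -- A step function with the same jumps as H on [0, T]: H - K is continuous there and has the
  -- derivative of H off P.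
  set K : ℝ → ℝ := fun x => ∑ p ∈ P,
      f p * ((SignType.sign (x - p) : ℝ) + SignType.sign (x - (p + T))) with hK
  have hHd : ∀ x, w x ≠ 0 → HasDerivAt H (φ (sz w B x / δ) * D x + φ (sz w B x / δ) * g x +
      err w w' B B' φ' δ x) x := by
    intro x hx
    have a1 : HasDerivAt (fun x => φ (sz w B x / δ))
        (φ' (sz w B x / δ) * (sz' w w' B B' x / δ)) x :=
      HasDerivAt.comp x (hφ _) ((h.hasDerivAt_sz x).div_const δ)
    have a2 := a1.mul (h.hasDerivAt_F x hx)
    refine a2.congr_deriv ?_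
    simp only [err, comp]; ring
  have hHz : ∀ x, sz w B x < δ → H =ᶠ[𝓝 x] fun _ => 0 := by
    intro x hx
    filter_upwards [h.continuous_sz.continuousAt.eventually_lt continuousAt_const hx] with y hy
    simp only [hH]
    rw [h1 _ ((div_le_one hδ).2 hy.le), zero_mul]
  have hHper : Function.Periodic H T := by
    intro x
    simp only [hH, sz, comp, h.periodic_w x, h.periodic_B x]
  have hcont : ∀ x ∈ Icc 0 T, ContinuousAt (fun x => H x - K x) x := by
    intro x hx
    refine continuousAt_sub_jumps h.T_pos P (fun p hp => ((hP p).1 hp).1) (fun p hp => ?_) hHper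
      (fun y hy hyP => ?_) hx
    · obtain ⟨-, hwp, hq⟩ := (hP p).1 hp
      have hBp : B p ≠ 0 := by
        rcases ne_zero_of_sz_pos (hδ.trans_le hq) with hh | hh
        · exact absurd hwp hh
        · exact hh
      exact continuousAt_inner_unit_sub_sign (μ := μ p) (h.deriv_eq p hwp ▸ h.hasDerivAt_w p) hwp
        h.continuous_B.continuousAt hs.continuousAt (h.mu_pos p hwp) hBp
    · by_cases hwy : w y = 0
      · have hq : sz w B y < δ := by
          by_contra! hc
          exact hyP ((hP y).2 ⟨hy, hwy, hc⟩)
        exact continuousAt_const.congr (hHz y hq).symm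
      · exact (hHd y hwy).continuousAt
  have key := integral_eq_of_hasDerivAt_off_countable (a := 0) (b := T) (fun x => H x - K x)
    (fun x => φ (sz w B x / δ) * D x + φ (sz w B x / δ) * g x + err w w' B B' φ' δ x)
    (s := (P : Set ℝ)) P.countable_toSet
    (fun x hx => (hcont x (by rwa [uIcc_of_le h.T_pos.le] at hx)).continuousWithinAt)
    (by
      rintro x ⟨hx, hxP⟩
      rw [min_eq_left h.T_pos.le, max_eq_right h.T_pos.le] at hx
      have hKd : HasDerivAt K 0 x := by
        have : HasDerivAt K (∑ p ∈ P, f p * (0 + 0)) x := by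
          refine HasDerivAt.fun_sum fun p hp => ?_
          have hp' := ((hP p).1 hp).1
          refine ((sign_hasDerivAt ?_).add (sign_hasDerivAt ?_)).const_mul (f p)
          · rintro rfl; exact hxP hp
          · have := hp'.1; have := hx.2; rintro hh; linarith
        simpa using this
      rw [← sub_zero (_ + _ + _)]
      refine HasDerivAt.sub ?_ hKd
      by_cases hwx : w x = 0
      · have hq : sz w B x < δ := by
          by_contra! hc
          exact hxP ((hP x).2 ⟨⟨hx.1.le, hx.2⟩, hwx, hc⟩)
        have hq1 : sz w B x / δ ≤ 1 := (div_le_one hδ).2 hq.le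
        have : φ (sz w B x / δ) * D x + φ (sz w B x / δ) * g x + err w w' B B' φ' δ x = 0 := by
          simp [err, h1 _ hq1, h3 _ hq1]
        rw [this]
        exact (hasDerivAt_const x 0).congr_of_eventuallyEq (hHz x hq)
      · exact hHd x hwx)
    ((i1.add i2).add i3)
  rw [intervalIntegral.integral_add (i1.add i2) i3, intervalIntegral.integral_add i1 i2] at key
  rw [key]
  have e1 := jumps_sub_jumps (T := T) (f := f) P (fun p hp => ((hP p).1 hp).1)
  have e2 : H T = H 0 := by simpa using hHper 0
  have e3 : K T - K 0 = 2 * ∑ p ∈ P, f p := e1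
  simp only [e2]
  linarith

/-- Integrating the derivative of the component of `B` along `w` over a period: every
nondegenerate zero `p` of `w` contributes `2‖B p‖`. -/
theorem integral_eq (h : JumpData T w w' B B' μ D g G) :
    IntervalIntegrable D volume 0 T ∧
    Summable (fun p : {x | x ∈ Ico 0 T ∧ w x = 0} => ‖B p‖) ∧
    ∫ x in 0..T, g x = -(∫ x in 0..T, D x) -
      2 * ∑' p : {x | x ∈ Ico 0 T ∧ w x = 0}, ‖B p‖ := by
  obtain ⟨φ, φ', M, hM0, hφ, hφ', h1, h2, hφ0, hφ1, hM, h3, h4⟩ := exists_cutoff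
  have hT := h.T_pos.le
  have hφc : Continuous φ := continuous_iff_continuousAt.2 fun t => (hφ t).continuousAt
  set d : ℕ → ℝ := fun k => 1 / ((k : ℝ) + 1) with hd
  have hd0 : ∀ k, 0 < d k := fun k => by positivity
  have hdlim : Tendsto d atTop (𝓝 0) := tendsto_one_div_add_atTop_nhds_zero_nat
  set θ : ℕ → ℝ → ℝ := fun k x => φ (sz w B x / d k) with hθ
  have hθc : ∀ k, Continuous (θ k) := fun k => hφc.comp (h.continuous_sz.div_const _)
  have hlarge : ∀ x, 0 < sz w B x → ∀ᶠ k in atTop, 2 ≤ sz w B x / d k := by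
    intro x hx
    filter_upwards [hdlim.eventually_lt_const (show 0 < sz w B x / 2 by positivity)] with k hk
    rw [le_div_iff₀ (hd0 k)]; linarith
  have hθlim : ∀ x, 0 < sz w B x → Tendsto (fun k => θ k x) atTop (𝓝 1) := by
    intro x hx
    refine tendsto_const_nhds.congr' ?_
    filter_upwards [hlarge x hx] with k hk
    exact (h2 _ hk).symm
  have hθmul : ∀ (u : ℝ → ℝ), (∀ x, sz w B x = 0 → u x = 0) → ∀ x,
      Tendsto (fun k => θ k x * u x) atTop (𝓝 (u x)) := by
    intro u hu x
    rcases (sz_nonneg w B x).eq_or_lt with hx | hx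
    · simp [hu x hx.symm]
    · simpa using (hθlim x hx).mul_const (u x)
  have hwz : ∀ x, sz w B x = 0 → w x = 0 := by
    intro x hx
    by_contra hc
    exact (sz_pos (B := B) (Or.inl hc)).ne' hx
  have hBz : ∀ x, sz w B x = 0 → B x = 0 := by
    intro x hx
    by_contra hc
    exact (sz_pos (w := w) (Or.inr hc)).ne' hx
  have hDlim := hθmul D fun x hx => h.D_zero x (hwz x hx)
  have hglim := hθmul g fun x hx => h.g_zero x (hwz x hx)
  -- At degenerate zeros `comp` is 0 because w = 0; elsewhere the argument of φ' eventually exceeds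
  -- 2.
  have herrlim : ∀ x, Tendsto (fun k => err w w' B B' φ' (d k) x) atTop (𝓝 0) := by
    intro x
    rcases (sz_nonneg w B x).eq_or_lt with hx | hx
    · simp [err, comp, hwz x hx.symm]
    · refine tendsto_const_nhds.congr' ?_
      filter_upwards [hlarge x hx] with k hk
      simp [err, h4 _ hk]
  have hfin : ∀ k, {x | x ∈ Ico 0 T ∧ w x = 0 ∧ d k ≤ sz w B x}.Finite := fun k =>
    finite_zeros (μ := μ) (fun x hx => h.deriv_eq x hx ▸ h.hasDerivAt_w x) h.mu_pos h.continuous_w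
      h.continuous_B (hd0 k) 0 T
  have hPmem : ∀ k x, x ∈ (hfin k).toFinset ↔ x ∈ Ico 0 T ∧ w x = 0 ∧ d k ≤ sz w B x := by
    intro k x; simp
  have hft := fun k => h.integral_cutoff hφ hφ' h1 h4 hφ0 hφ1 hM h3 (hd0 k)
    (hfin k).toFinset (hPmem k)
  set Z : Set ℝ := {x | x ∈ Ico 0 T ∧ w x = 0} with hZ
  set f : ℕ → Z → ℝ := fun k p => θ k p * ‖B p‖ with hf
  have hfnn : ∀ k p, 0 ≤ f k p := fun k p => mul_nonneg (hφ0 _) (norm_nonneg _)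
  have hsum : ∀ k, HasSum (f k) (∑ p ∈ (hfin k).toFinset, φ (sz w B p / d k) * ‖B p‖) := by
    intro k
    have hsub : ((hfin k).toFinset : Set ℝ) ⊆ Z := by
      intro x hx
      have := (hPmem k x).1 hx
      exact ⟨this.1, this.2.1⟩
    have a1 : HasSum (Z.indicator fun p => φ (sz w B p / d k) * ‖B p‖)
        (∑ p ∈ (hfin k).toFinset, Z.indicator (fun p => φ (sz w B p / d k) * ‖B p‖) p) := by
      refine hasSum_sum_of_ne_finset_zero fun p hp => ?_
      by_cases hpZ : p ∈ Z
      · rw [indicator_of_mem hpZ]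
        have : sz w B p < d k := by
          by_contra! hc
          exact hp ((hPmem k p).2 ⟨hpZ.1, hpZ.2, hc⟩)
        rw [h1 _ ((div_le_one (hd0 k)).2 this.le), zero_mul]
      · exact indicator_of_notMem hpZ _
    rw [Finset.sum_congr rfl fun p hp => indicator_of_mem (hsub hp) _] at a1
    exact (hasSum_subtype_iff_indicator (f := fun p => φ (sz w B p / d k) * ‖B p‖)).2 a1
  have habsg : ∀ k, |∫ x in 0..T, θ k x * g x| ≤ ∫ x in 0..T, G x := by
    intro k
    rw [← Real.norm_eq_abs]
    refine intervalIntegral.norm_integral_le_of_norm_le hT ?_ (h.continuous_G.intervalIntegrable _ _)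
    refine Eventually.of_forall fun x _ => ?_
    rw [Real.norm_eq_abs, abs_mul, abs_of_nonneg (hφ0 _)]
    exact (mul_le_of_le_one_left (abs_nonneg _) (hφ1 _)).trans (h.abs_g_le x)
  have hGe : Continuous fun x => 4 * M * (‖B' x‖ + ‖w' x‖) :=
    continuous_const.mul (h.continuous_B'.norm.add h.continuous_w'.norm)
  have habse : ∀ k, |∫ x in 0..T, err w w' B B' φ' (d k) x| ≤
      ∫ x in 0..T, 4 * M * (‖B' x‖ + ‖w' x‖) := by
    intro k
    rw [← Real.norm_eq_abs]
    refine intervalIntegral.norm_integral_le_of_norm_le hT ?_ (hGe.intervalIntegrable _ _)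
    exact Eventually.of_forall fun x _ => abs_err_le (hd0 k) hM h4 x
  set C : ℝ := (∫ x in 0..T, G x) + ∫ x in 0..T, 4 * M * (‖B' x‖ + ‖w' x‖) with hC
  have hSnn : ∀ k, 0 ≤ ∑ p ∈ (hfin k).toFinset, φ (sz w B p / d k) * ‖B p‖ := fun k =>
    Finset.sum_nonneg fun p _ => mul_nonneg (hφ0 _) (norm_nonneg _)
  have hDnn : ∀ k, 0 ≤ ∫ x in 0..T, θ k x * D x := fun k =>
    intervalIntegral.integral_nonneg hT fun x _ => mul_nonneg (hφ0 _) (h.D_nonneg x)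
  -- In the cut-off identity the dissipation and jump terms are both nonnegative, so the bounds on
  -- the g and error integrals control each of them.
  have hDle : ∀ k, ∫ x in 0..T, θ k x * D x ≤ C := by
    intro k
    have := hft k; have := hSnn k
    have := (abs_le.1 (habsg k)).1; have := (abs_le.1 (habse k)).1
    simp only [hθ] at *
    linarith
  have hSle : ∀ k, ∑ p ∈ (hfin k).toFinset, φ (sz w B p / d k) * ‖B p‖ ≤ C := by
    intro k
    have := hft k; have := hSnn k; have := hDnn k
    have := (abs_le.1 (habsg k)).1; have := (abs_le.1 (habse k)).1
    simp only [hθ] at *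
    linarith
  have hDkc : ∀ k, Continuous fun x => θ k x * D x := fun k =>
    h.continuous_cutoff_mul_D hφc h1 (hd0 k)
  have hDint : IntervalIntegrable D volume 0 T := by
    rw [intervalIntegrable_iff_integrableOn_Ioc_of_le hT]
    -- Fatou: the cut-off functions converge pointwise to D and their integrals are at most C.
    refine integrable_of_tendsto (G := fun k x => θ k x * D x) (Eventually.of_forall hDlim)
      (fun k => (hDkc k).aestronglyMeasurable) (ne_top_of_le_ne_top
        (ENNReal.ofReal_ne_top (r := C)) ?_)
    refine liminf_le_of_frequently_le' (Frequently.of_forall fun k => ?_)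
    have hi : IntegrableOn (fun x => θ k x * D x) (Ioc 0 T) :=
      (intervalIntegrable_iff_integrableOn_Ioc_of_le hT).1 ((hDkc k).intervalIntegrable _ _)
    have hnn : ∀ x, 0 ≤ θ k x * D x := fun x => mul_nonneg (hφ0 _) (h.D_nonneg x)
    have e : ∫⁻ x in Ioc 0 T, ‖θ k x * D x‖ₑ = ENNReal.ofReal (∫ x in Ioc 0 T, θ k x * D x) := by
      rw [ofReal_integral_eq_lintegral_ofReal hi (Eventually.of_forall hnn)]
      refine lintegral_congr fun x => ?_
      rw [Real.enorm_eq_ofReal (hnn x)]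
    rw [e, ← intervalIntegral.integral_of_le hT]
    exact ENNReal.ofReal_le_ofReal (hDle k)
  have hsummable : Summable (fun p : Z => ‖B p‖) := by
    refine summable_of_sum_le (c := C) (fun p => norm_nonneg _) fun u => ?_
    have hlim : Tendsto (fun k => ∑ p ∈ u, f k p) atTop (𝓝 (∑ p ∈ u, ‖B p‖)) :=
      tendsto_finsetSum _ fun p _ => hθmul (fun x => ‖B x‖) (fun x hx => by simp [hBz x hx]) p
    refine le_of_tendsto hlim (Eventually.of_forall fun k => ?_)
    exact (sum_le_hasSum u (fun p _ => hfnn k p) (hsum k)).trans (hSle k)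
  refine ⟨hDint, hsummable, ?_⟩
  have l1 : Tendsto (fun k => ∫ x in 0..T, θ k x * D x) atTop (𝓝 (∫ x in 0..T, D x)) := by
    refine intervalIntegral.tendsto_integral_filter_of_dominated_convergence D
      (Eventually.of_forall fun k => (hDkc k).aestronglyMeasurable)
      (Eventually.of_forall fun k => Eventually.of_forall fun x _ => ?_) hDint
      (Eventually.of_forall fun x _ => hDlim x)
    rw [Real.norm_eq_abs, abs_mul, abs_of_nonneg (hφ0 _), abs_of_nonneg (h.D_nonneg x)]
    exact mul_le_of_le_one_left (h.D_nonneg x) (hφ1 _)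
  have l2 : Tendsto (fun k => ∫ x in 0..T, θ k x * g x) atTop (𝓝 (∫ x in 0..T, g x)) := by
    refine intervalIntegral.tendsto_integral_filter_of_dominated_convergence G
      (Eventually.of_forall fun k => ((hθc k).measurable.mul h.measurable_g).aestronglyMeasurable)
      (Eventually.of_forall fun k => Eventually.of_forall fun x _ => ?_)
      (h.continuous_G.intervalIntegrable _ _) (Eventually.of_forall fun x _ => hglim x)
    rw [Real.norm_eq_abs, abs_mul, abs_of_nonneg (hφ0 _)]
    exact (mul_le_of_le_one_left (abs_nonneg _) (hφ1 _)).trans (h.abs_g_le x)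
  have l3 : Tendsto (fun k => ∫ x in 0..T, err w w' B B' φ' (d k) x) atTop (𝓝 0) := by
    have := intervalIntegral.tendsto_integral_filter_of_dominated_convergence
      (μ := volume) (a := 0) (b := T) (l := atTop)
      (F := fun k x => err w w' B B' φ' (d k) x) (f := fun _ => 0)
      (fun x => 4 * M * (‖B' x‖ + ‖w' x‖))
      (Eventually.of_forall fun k => (h.measurable_err hφ' (d k)).aestronglyMeasurable)
      (Eventually.of_forall fun k => Eventually.of_forall fun x _ => abs_err_le (hd0 k) hM h4 x)
      (hGe.intervalIntegrable _ _) (Eventually.of_forall fun x _ => herrlim x)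
    simpa using this
  have l4 : Tendsto (fun k => ∑' p : Z, f k p) atTop (𝓝 (∑' p : Z, ‖B p‖)) := by
    refine tendsto_tsum_of_dominated_convergence hsummable
      (fun p => hθmul (fun x => ‖B x‖) (fun x hx => by simp [hBz x hx]) p)
      (Eventually.of_forall fun k p => ?_)
    rw [Real.norm_eq_abs, abs_of_nonneg (hfnn k p)]
    exact mul_le_of_le_one_left (norm_nonneg _) (hφ1 _)
  have l5 : Tendsto (fun k => -(2 * ∑' p : Z, f k p)) atTop
      (𝓝 ((∫ x in 0..T, D x) + (∫ x in 0..T, g x) + 0)) := by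
    refine ((l1.add l2).add l3).congr fun k => ?_
    rw [(hsum k).tsum_eq]
    exact hft k
  have := tendsto_nhds_unique l5 ((l4.const_mul 2).neg)
  linarith

end JumpData

/-! ### Algebra and calculus of the cross product -/

section CrossProduct

theorem inner_eq_coords (u v : E3) : inner ℝ u v = u 0 * v 0 + u 1 * v 1 + u 2 * v 2 := by
  simp [PiLp.inner_apply, Fin.sum_univ_three]; ring

theorem cross_coords (u v : E3) : cross u v =
    !₂[u 1 * v 2 - u 2 * v 1, u 2 * v 0 - u 0 * v 2, u 0 * v 1 - u 1 * v 0] := by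
  simp [cross, cross_apply]

theorem inner_cross_cross (a b c d : E3) : inner ℝ (cross a b) (cross c d) =
    inner ℝ a c * inner ℝ b d - inner ℝ a d * inner ℝ b c := by
  simp only [inner_eq_coords, cross_coords]; simp; ring

theorem cross_cross_right (a b c : E3) :
    cross a (cross b c) = inner ℝ a c • b - inner ℝ a b • c := by
  ext i
  fin_cases i <;> simp [inner_eq_coords, cross_coords] <;> ring

theorem cross_cross_left (a b c : E3) :
    cross (cross a b) c = inner ℝ a c • b - inner ℝ b c • a := by
  ext i
  fin_cases i <;> simp [inner_eq_coords, cross_coords] <;> ring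

theorem inner_cross_left_self (a b : E3) : inner ℝ (cross a b) a = 0 := by
  simp only [inner_eq_coords, cross_coords]; simp; ring

theorem inner_cross_right_self (a b : E3) : inner ℝ (cross a b) b = 0 := by
  simp only [inner_eq_coords, cross_coords]; simp; ring

theorem inner_cross_sq (a b c : E3) : inner ℝ (cross a b) c ^ 2 =
    inner ℝ a a * inner ℝ b b * inner ℝ c c + 2 * inner ℝ a b * inner ℝ b c * inner ℝ a c
    - inner ℝ a a * inner ℝ b c ^ 2 - inner ℝ b b * inner ℝ a c ^ 2
    - inner ℝ c c * inner ℝ a b ^ 2 := by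
  simp only [inner_eq_coords, cross_coords]; simp; ring

theorem inner_cross_rotate (a b c : E3) : inner ℝ (cross a b) c = inner ℝ (cross c a) b := by
  simp only [inner_eq_coords, cross_coords]; simp; ring

theorem inner_cross_swap (a b c : E3) : inner ℝ (cross a b) c = -inner ℝ (cross b a) c := by
  simp only [inner_eq_coords, cross_coords]; simp; ring

theorem cross_self_eq_zero (a : E3) : cross a a = 0 := by simp [cross]

theorem cross_add_left (a b c : E3) : cross (a + b) c = cross a c + cross b c := by
  simp [cross]

theorem cross_add_right (a b c : E3) : cross a (b + c) = cross a b + cross a c := by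
  simp [cross]

theorem cross_smul_left (t : ℝ) (a b : E3) : cross (t • a) b = t • cross a b := by
  simp [cross]

theorem cross_smul_right (t : ℝ) (a b : E3) : cross a (t • b) = t • cross a b := by
  simp [cross]

/-- The cross product as a continuous bilinear map. -/
noncomputable def crossL : E3 →L[ℝ] E3 →L[ℝ] E3 :=
  (LinearMap.mk₂ ℝ cross cross_add_left cross_smul_left cross_add_right
    cross_smul_right).toContinuousBilinearMap

theorem HasDerivAt.cross3 {f g : ℝ → E3} {f' g' : E3} {x : ℝ} (hf : HasDerivAt f f' x)
    (hg : HasDerivAt g g' x) :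
    HasDerivAt (fun y => cross (f y) (g y)) (cross (f x) g' + cross f' (g x)) x :=
  crossL.hasDerivAt_of_bilinear (u := f) (v := g) (fun _ => hf) fun _ => hg

theorem ContDiffOn.cross3 {X : Type*} [NormedAddCommGroup X] [NormedSpace ℝ X] {f g : X → E3}
    {n : ℕ∞ω} {s : Set X} (hf : ContDiffOn ℝ n f s) (hg : ContDiffOn ℝ n g s) :
    ContDiffOn ℝ n (fun y => cross (f y) (g y)) s :=
  crossL.isBoundedBilinearMap.contDiff.comp_contDiffOn (hf.prodMk hg)

theorem ContDiff.cross3 {X : Type*} [NormedAddCommGroup X] [NormedSpace ℝ X] {f g : X → E3}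
    {n : ℕ∞ω} (hf : ContDiff ℝ n f) (hg : ContDiff ℝ n g) :
    ContDiff ℝ n (fun y => cross (f y) (g y)) :=
  crossL.isBoundedBilinearMap.contDiff.comp (hf.prodMk hg)

theorem Continuous.cross3 {X : Type*} [TopologicalSpace X] {f g : X → E3}
    (hf : Continuous f) (hg : Continuous g) : Continuous (fun y => cross (f y) (g y)) :=
  crossL.isBoundedBilinearMap.continuous.comp (hf.prodMk hg)

theorem norm_sq_cross (a b : E3) :
    ‖cross a b‖ ^ 2 = ‖a‖ ^ 2 * ‖b‖ ^ 2 - inner ℝ a b ^ 2 := by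
  rw [← real_inner_self_eq_norm_sq, inner_cross_cross, real_inner_self_eq_norm_sq,
    real_inner_self_eq_norm_sq, real_inner_comm b a]; ring

end CrossProduct

/-! ### Angle, curvature and dissipation in terms of cross products -/

section Pointwise

variable {c : ℝ → E3} {x : ℝ}

theorem cos_psi (h0 : c x ≠ 0) (h1 : deriv c x ≠ 0) :
    cos (psi c x) = ‖cross (c x) (deriv c x)‖ / (‖c x‖ * ‖deriv c x‖) := by
  have hr := norm_pos_iff.2 h0
  have hn := norm_pos_iff.2 h1
  rw [psi, cos_arcsin]
  have h : 1 - (inner ℝ (c x) (deriv c x) / (‖c x‖ * ‖deriv c x‖)) ^ 2 =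
      (‖cross (c x) (deriv c x)‖ / (‖c x‖ * ‖deriv c x‖)) ^ 2 := by
    rw [div_pow, div_pow, norm_sq_cross]
    field_simp
  rw [h, Real.sqrt_sq (by positivity)]

theorem psi_eq_iff (h0 : c x ≠ 0) (h1 : deriv c x ≠ 0) :
    (psi c x = π / 2 ∨ psi c x = -(π / 2)) ↔ cross (c x) (deriv c x) = 0 := by
  have hr := norm_pos_iff.2 h0
  have hn := norm_pos_iff.2 h1
  have hcos := cos_psi h0 h1
  have h2 : cos (psi c x) = 0 ↔ cross (c x) (deriv c x) = 0 := by
    rw [hcos, div_eq_zero_iff, norm_eq_zero]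
    exact or_iff_left (by positivity)
  rw [← h2]
  constructor
  · rintro (h | h) <;> simp [h]
  · intro h
    by_contra! hc
    have l := (neg_pi_div_two_le_arcsin (inner ℝ (c x) (deriv c x) / (‖c x‖ * ‖deriv c x‖))).lt_of_ne
      hc.2.symm
    have u := (arcsin_le_pi_div_two (inner ℝ (c x) (deriv c x) / (‖c x‖ * ‖deriv c x‖))).lt_of_ne hc.1
    exact (cos_pos_of_mem_Ioo ⟨l, u⟩).ne' h

theorem sphereLengthDensity_eq (h0 : c x ≠ 0) (h1 : deriv c x ≠ 0) :
    sphereLengthDensity c x = ‖(‖c x‖ ^ 2)⁻¹ • cross (c x) (deriv c x)‖ := by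
  have hr := norm_pos_iff.2 h0
  have hn := norm_pos_iff.2 h1
  rw [sphereLengthDensity, cos_psi h0 h1, norm_smul, norm_inv, norm_pow, norm_norm]
  field_simp

theorem norm_smul_sub (u v : E3) : ‖inner ℝ v v • u - inner ℝ v u • v‖ = ‖v‖ * ‖cross u v‖ := by
  rw [← cross_cross_right]
  refine (sq_eq_sq₀ (norm_nonneg _) (by positivity)).1 ?_
  rw [mul_pow, norm_sq_cross v, real_inner_comm, inner_cross_right_self]
  ring

theorem norm_curvatureVector (h1 : deriv c x ≠ 0) : ‖curvatureVector c x‖ = curvature c x := by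
  have hn := norm_pos_iff.2 h1
  rw [curvatureVector, curvature, cross_cross_right, norm_smul, norm_smul_sub, norm_inv, norm_pow,
    norm_norm]
  field_simp

theorem inner_curvatureVector_deriv (c : ℝ → E3) (x : ℝ) :
    inner ℝ (curvatureVector c x) (deriv c x) = 0 := by
  rw [curvatureVector, inner_smul_left, inner_cross_left_self, mul_zero]

theorem deriv_deriv_eq (h1 : deriv c x ≠ 0) : deriv (deriv c) x = ‖deriv c x‖ ^ 2 •
    curvatureVector c x + (inner ℝ (deriv c x) (deriv (deriv c) x) / ‖deriv c x‖ ^ 2) •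
      deriv c x := by
  have hn := norm_pos_iff.2 h1
  rw [curvatureVector, cross_cross_right, real_inner_self_eq_norm_sq, smul_sub, smul_sub, smul_smul,
    smul_smul, smul_smul, smul_smul]
  rw [show ‖deriv c x‖ ^ 2 * (‖deriv c x‖ ^ 4)⁻¹ * ‖deriv c x‖ ^ 2 = 1 by field_simp,
    show ‖deriv c x‖ ^ 2 * (‖deriv c x‖ ^ 4)⁻¹ * inner ℝ (deriv c x) (deriv (deriv c) x) =
      inner ℝ (deriv c x) (deriv (deriv c) x) / ‖deriv c x‖ ^ 2 by field_simp]
  simp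

/-- ν × c' is a positive multiple of c'' × c' when κ ≠ 0, so the projection is a triple product over
|c'' × c'| and the factor κ² cancels that denominator. Where κ = 0 or c × c' = 0 both sides are 0,
by division by zero if necessary. -/
theorem dissipationDensity_eq (h0 : c x ≠ 0) (h1 : deriv c x ≠ 0) :
    dissipationDensity c x = inner ℝ (cross (c x) (deriv c x)) (deriv (deriv c) x) ^ 2 /
      (‖deriv c x‖ ^ 2 * ‖cross (c x) (deriv c x)‖ ^ 3) := by
  have hr := norm_pos_iff.2 h0
  have hn := norm_pos_iff.2 h1
  rw [dissipationDensity, cos_psi h0 h1, curvature]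
  set k := ‖cross (deriv (deriv c) x) (deriv c x)‖ with hk
  have hin : inner ℝ (cross (c x) (deriv c x)) (deriv (deriv c) x) =
      -inner ℝ (cross (deriv (deriv c) x) (deriv c x)) (c x) := by
    rw [inner_cross_rotate, inner_cross_rotate, inner_cross_swap]
  by_cases hk0 : k = 0
  · rw [hin, norm_eq_zero.1 hk0, hk0]; simp
  have hkp : 0 < k := lt_of_le_of_ne (norm_nonneg _) (Ne.symm hk0)
  have hv : cross (unitNormal c x) (deriv c x) =
      (‖deriv c x‖ / k) • cross (deriv (deriv c) x) (deriv c x) := by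
    rw [unitNormal, cross_smul_left, cross_cross_left, real_inner_self_eq_norm_sq, ← hk,
      inner_cross_right_self, zero_smul, sub_zero, smul_smul]
    congr 1
    field_simp
  have hproj : ‖projLine (cross (unitNormal c x) (deriv c x)) (c x)‖ =
      |inner ℝ (cross (c x) (deriv c x)) (deriv (deriv c) x)| / k := by
    rw [projLine, Submodule.starProjection_singleton, hv, norm_smul, norm_smul, inner_smul_left,
      ← hk, hin, abs_neg]
    simp only [RCLike.ofReal_real_eq_id, id_eq, norm_div, norm_pow, norm_mul,
      Real.norm_eq_abs, conj_trivial, abs_norm, abs_of_pos hkp]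
    field_simp
  rw [hproj, div_pow |_|, sq_abs]
  rcases eq_or_ne (cross (c x) (deriv c x)) 0 with hw | hw
  · simp [hw]
  have hW := norm_pos_iff.2 hw
  field_simp

end Pointwise

/-! ### The flux and its derivative -/

section Curve

/-- The vector field whose component along `c × c'` is the boundary flux of the first variation of
the length of the radial projection. -/
noncomputable def fluxField (c : ℝ → E3) (x : ℝ) : E3 :=
  (inner ℝ (c x) (deriv c x) / (‖c x‖ ^ 2 * (‖deriv c x‖ ^ 2) ^ 2)) •
    cross (deriv c x) (deriv (deriv c) x)

/-- The variation of `c × c'` under the motion with velocity the curvature vector. -/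
noncomputable def crossRate (c : ℝ → E3) (x : ℝ) : E3 :=
  cross (curvatureVector c x) (deriv c x) + cross (c x) (deriv (curvatureVector c) x)

/-- The time derivative of the density of the length of the radial projection. -/
noncomputable def densityRate (c : ℝ → E3) (x : ℝ) : ℝ :=
  inner ℝ (cross (c x) (deriv c x)) (crossRate c x) / (‖cross (c x) (deriv c x)‖ * ‖c x‖ ^ 2) -
    2 * inner ℝ (c x) (curvatureVector c x) * ‖cross (c x) (deriv c x)‖ / (‖c x‖ ^ 2) ^ 2

/-- The scalar core of F' = D + g. Here r = |c|², n = |c'|², p = ⟨c, c'⟩, l = ⟨c', c''⟩, a = ⟨c, V⟩,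
v = |V|², β = ⟨c, V'⟩ and W = |c × c'|, with V the curvature vector. The left side is the quotient
rule for -ap / (rW). -/
theorem density_rate_identity {r n p l a v β W : ℝ} (hr : 0 < r) (hn : 0 < n) (hW : 0 < W)
    (h : W ^ 2 = r * n - p ^ 2) :
    (-(β * p + a * (n + n * a + l * p / n)) * (r * W) + a * p * (2 * p * W +
      r * ((2 * p * n + r * (2 * l) - 2 * p * (n + n * a + l * p / n)) / (2 * W)))) / (r * W) ^ 2 =
    n * (W ^ 2 * v - a ^ 2 * n) / W ^ 3 +
      ((a * n - r * n * v - p * β) / (W * r) - 2 * a * W / r ^ 2) := by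
  have hr' : r = (W ^ 2 + p ^ 2) / n := by field_simp; linarith
  have h2 : 0 < W ^ 2 + p ^ 2 := by positivity
  subst hr'
  field_simp
  ring

variable {c : ℝ → E3}

theorem contDiff_deriv (hc : ContDiff ℝ ∞ c) : ContDiff ℝ ∞ (deriv c) :=
  (contDiff_infty_iff_deriv.1 hc).2

theorem hasDerivAt_of_contDiff {f : ℝ → E3} (hf : ContDiff ℝ ∞ f) (x : ℝ) :
    HasDerivAt f (deriv f x) x :=
  (hf.differentiable (by simp) x).hasDerivAt

theorem contDiff_curvatureVector (hc : ContDiff ℝ ∞ c) (h1 : ∀ x, deriv c x ≠ 0) :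
    ContDiff ℝ ∞ (curvatureVector c) := by
  have hc1 := contDiff_deriv hc
  have hc2 := contDiff_deriv hc1
  have e : curvatureVector c = fun x => ((‖deriv c x‖ ^ 2) ^ 2)⁻¹ •
      cross (deriv c x) (cross (deriv (deriv c) x) (deriv c x)) := by
    ext1 x; rw [curvatureVector, ← pow_mul]
  rw [e]
  refine ContDiff.smul (ContDiff.inv ((hc1.norm_sq ℝ).pow 2) fun x => ?_)
    (hc1.cross3 (hc2.cross3 hc1))
  have := norm_pos_iff.2 (h1 x); positivity

theorem contDiff_fluxField (hc : ContDiff ℝ ∞ c) (h0 : ∀ x, c x ≠ 0) (h1 : ∀ x, deriv c x ≠ 0) :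
    ContDiff ℝ ∞ (fluxField c) := by
  have hc1 := contDiff_deriv hc
  have hc2 := contDiff_deriv hc1
  refine ContDiff.smul (ContDiff.div (hc.inner ℝ hc1) ((hc.norm_sq ℝ).mul ((hc1.norm_sq ℝ).pow 2))
    fun x => ?_) (hc1.cross3 hc2)
  have := norm_pos_iff.2 (h0 x); have := norm_pos_iff.2 (h1 x); positivity

theorem hasDerivAt_cross_deriv (hc : ContDiff ℝ ∞ c) (x : ℝ) :
    HasDerivAt (fun y => cross (c y) (deriv c y)) (cross (c x) (deriv (deriv c) x)) x := by
  have := (hasDerivAt_of_contDiff hc x).cross3 (hasDerivAt_of_contDiff (contDiff_deriv hc) x)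
  rwa [cross_self_eq_zero, add_zero] at this

theorem inner_fluxField {x : ℝ} (h0 : c x ≠ 0) (h1 : deriv c x ≠ 0) :
    inner ℝ (fluxField c x) (cross (c x) (deriv c x)) =
      -(inner ℝ (c x) (curvatureVector c x) * inner ℝ (c x) (deriv c x)) / ‖c x‖ ^ 2 := by
  have hr := norm_pos_iff.2 h0
  have hn := norm_pos_iff.2 h1
  have h2 : inner ℝ (c x) (deriv (deriv c) x) = ‖deriv c x‖ ^ 2 *
      inner ℝ (c x) (curvatureVector c x) + inner ℝ (deriv c x) (deriv (deriv c) x) /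
        ‖deriv c x‖ ^ 2 * inner ℝ (c x) (deriv c x) := by
    conv_lhs => rw [deriv_deriv_eq h1]
    rw [inner_add_right, inner_smul_right, inner_smul_right]
  rw [fluxField, inner_smul_left, inner_cross_cross, real_inner_comm (c x) (deriv (deriv c) x),
    h2, real_inner_self_eq_norm_sq, real_inner_comm (c x) (deriv c x),
    real_inner_comm (deriv c x) (deriv (deriv c) x)]
  simp only [conj_trivial]
  field_simp
  ring

/-- Everything reduces to scalar products by splitting c'' into |c'|²V and a tangential part, and by
differentiating ⟨V, c'⟩ = 0 to find ⟨V', c'⟩. -/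
theorem hasDerivAt_flux (hc : ContDiff ℝ ∞ c) (h0 : ∀ x, c x ≠ 0) (h1 : ∀ x, deriv c x ≠ 0)
    {x : ℝ} (hx : cross (c x) (deriv c x) ≠ 0) :
    HasDerivAt (fun y => inner ℝ (fluxField c y) (cross (c y) (deriv c y)) /
      ‖cross (c y) (deriv c y)‖) (dissipationDensity c x + densityRate c x) x := by
  have hc1 := contDiff_deriv hc
  have hV := contDiff_curvatureVector hc h1
  have dc := hasDerivAt_of_contDiff hc x
  have dc1 := hasDerivAt_of_contDiff hc1 x
  have dV := hasDerivAt_of_contDiff hV x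
  have hr := norm_pos_iff.2 (h0 x)
  have hn := norm_pos_iff.2 (h1 x)
  have hW := norm_pos_iff.2 hx
  have e : (fun y => inner ℝ (fluxField c y) (cross (c y) (deriv c y)) /
      ‖cross (c y) (deriv c y)‖) = fun y =>
      -(inner ℝ (c y) (curvatureVector c y) * inner ℝ (c y) (deriv c y)) / (‖c y‖ ^ 2 *
        √(‖c y‖ ^ 2 * ‖deriv c y‖ ^ 2 - inner ℝ (c y) (deriv c y) ^ 2)) := by
    ext1 y
    rw [inner_fluxField (h0 y) (h1 y), ← norm_sq_cross, Real.sqrt_sq (norm_nonneg _), div_div]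
  have hVc1 : inner ℝ (curvatureVector c x) (deriv c x) = 0 := inner_curvatureVector_deriv c x
  have hV'c1 : inner ℝ (deriv (curvatureVector c) x) (deriv c x) =
      -inner ℝ (curvatureVector c x) (deriv (deriv c) x) := by
    have d := dV.inner ℝ dc1
    have z : (fun y => inner ℝ (curvatureVector c y) (deriv c y)) = fun _ => 0 := by
      ext1 y; exact inner_curvatureVector_deriv c y
    rw [z] at d
    have := d.unique (hasDerivAt_const x 0)
    linarith
  set V := curvatureVector c x with hVdef
  set V' := deriv (curvatureVector c) x with hV'def
  set l := inner ℝ (deriv c x) (deriv (deriv c) x) with hl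
  set p := inner ℝ (c x) (deriv c x) with hp
  set a := inner ℝ (c x) V with ha
  have hc2 := deriv_deriv_eq (h1 x)
  rw [← hl, ← hVdef] at hc2
  have hcc2 : inner ℝ (c x) (deriv (deriv c) x) = ‖deriv c x‖ ^ 2 * a + l * p / ‖deriv c x‖ ^ 2 := by
    rw [hc2, inner_add_right, inner_smul_right, inner_smul_right]; ring
  have hVc2 : inner ℝ V (deriv (deriv c) x) = ‖deriv c x‖ ^ 2 * ‖V‖ ^ 2 := by
    rw [hc2, inner_add_right, inner_smul_right, inner_smul_right, hVc1,
      real_inner_self_eq_norm_sq]; ring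
  have hc1V : inner ℝ (deriv c x) V = 0 := by rw [real_inner_comm, hVc1]
  have hWsq := norm_sq_cross (c x) (deriv c x)
  rw [← hp] at hWsq
  have hY : inner ℝ (cross (c x) (deriv c x)) (crossRate c x) = a * ‖deriv c x‖ ^ 2 -
      ‖c x‖ ^ 2 * ‖deriv c x‖ ^ 2 * ‖V‖ ^ 2 - p * inner ℝ (c x) V' := by
    rw [crossRate, inner_add_right, inner_cross_cross, inner_cross_cross, ← hVdef, ← hV'def, hc1V,
      real_inner_self_eq_norm_sq, real_inner_self_eq_norm_sq, real_inner_comm (c x) (deriv c x),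
      real_inner_comm V' (deriv c x), hV'c1, hVc2]
    ring
  have hD : dissipationDensity c x = ‖deriv c x‖ ^ 2 * (‖cross (c x) (deriv c x)‖ ^ 2 * ‖V‖ ^ 2 -
      a ^ 2 * ‖deriv c x‖ ^ 2) / ‖cross (c x) (deriv c x)‖ ^ 3 := by
    rw [dissipationDensity_eq (h0 x) (h1 x)]
    have : inner ℝ (cross (c x) (deriv c x)) (deriv (deriv c) x) =
        ‖deriv c x‖ ^ 2 * inner ℝ (cross (c x) (deriv c x)) V := by
      rw [hc2, inner_add_right, inner_smul_right, inner_smul_right, inner_cross_right_self]; ring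
    rw [this, mul_pow, inner_cross_sq, hc1V, hWsq]
    simp only [real_inner_self_eq_norm_sq]
    rw [← hp, ← ha]
    field_simp
    ring
  rw [e]
  have dr : HasDerivAt (fun y => ‖c y‖ ^ 2) (2 * p) x := dc.norm_sq
  have dn : HasDerivAt (fun y => ‖deriv c y‖ ^ 2) (2 * l) x := dc1.norm_sq
  have dp : HasDerivAt (fun y => inner ℝ (c y) (deriv c y))
      (‖deriv c x‖ ^ 2 + ‖deriv c x‖ ^ 2 * a + l * p / ‖deriv c x‖ ^ 2) x := by
    refine (dc.inner ℝ dc1).congr_deriv ?_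
    rw [hcc2, real_inner_self_eq_norm_sq]; ring
  have da : HasDerivAt (fun y => inner ℝ (c y) (curvatureVector c y)) (inner ℝ (c x) V') x := by
    refine (dc.inner ℝ dV).congr_deriv ?_
    rw [← hVdef, hc1V, add_zero]
  have hQ : ‖c x‖ ^ 2 * ‖deriv c x‖ ^ 2 - inner ℝ (c x) (deriv c x) ^ 2 ≠ 0 := by
    rw [← norm_sq_cross]; positivity
  have hsq : √(‖c x‖ ^ 2 * ‖deriv c x‖ ^ 2 - p ^ 2) = ‖cross (c x) (deriv c x)‖ := by
    rw [← hWsq, Real.sqrt_sq (norm_nonneg _)]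
  have dW := ((dr.mul dn).sub (dp.pow 2)).sqrt hQ
  have key := (da.mul dp).neg.div (dr.mul dW) (by
    simp only [Pi.mul_apply, Pi.sub_apply, Pi.pow_apply]
    rw [← hp, hsq]; positivity)
  refine key.congr_deriv ?_
  simp only [Pi.mul_apply, Pi.sub_apply, Pi.pow_apply, Pi.neg_apply]
  rw [hD, densityRate, hY, ← hVdef, ← ha, ← hp, hsq, ← density_rate_identity (l := l)
    (pow_pos hr 2) (pow_pos hn 2) hW hWsq]
  congr 1
  norm_num

end Curve

/-! ### Continuity of the dissipation at nondegenerate radial points -/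

section DissipationContinuity

theorem eventually_abs_le_mul_sq {d d' : ℝ → ℝ} {p : ℝ} (hd : ∀ x, HasDerivAt d (d' x) x)
    (hd' : DifferentiableAt ℝ d' p) (h0 : d p = 0) (h0' : d' p = 0) :
    ∃ C, ∀ᶠ x in 𝓝 p, |d x| ≤ C * |x - p| ^ 2 := by
  obtain ⟨C, hC⟩ := hd'.isBigO_sub.bound
  obtain ⟨ε, hε, hball⟩ := Metric.eventually_nhds_iff_ball.1 hC
  refine ⟨|C|, Metric.eventually_nhds_iff_ball.2 ⟨ε, hε, fun x hx => ?_⟩⟩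
  have key := Convex.norm_image_sub_le_of_norm_hasDerivWithin_le (f := d) (f' := d')
    (C := |C| * |x - p|) (s := Metric.closedBall p |x - p|) (x := p) (y := x)
    (fun y _ => (hd y).hasDerivWithinAt) (fun y hy => ?_) (convex_closedBall _ _)
    (Metric.mem_closedBall_self (abs_nonneg _)) (by simp [Real.dist_eq])
  · rw [h0, sub_zero, Real.norm_eq_abs, Real.norm_eq_abs] at key
    calc _ ≤ _ := key
      _ = _ := by ring
  · rw [Metric.mem_closedBall, Real.dist_eq] at hy
    have hy' := hball y (by
      rw [Metric.mem_ball, Real.dist_eq] at hx ⊢; exact hy.trans_lt hx)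
    rw [h0', sub_zero] at hy'
    refine hy'.trans ?_
    rw [Real.norm_eq_abs]
    exact mul_le_mul (le_abs_self _) hy (abs_nonneg _) (abs_nonneg _)

/-- The numerator is O(|x - p|⁴), while the denominator is of exact order |x - p|³; the quotient
tends to 0, its value at p under division by zero. -/
theorem continuousAt_sq_div_norm_cube {E : Type*} [NormedAddCommGroup E] [NormedSpace ℝ E]
    {d d' N : ℝ → ℝ} {w : ℝ → E} {w' : E} {p : ℝ}
    (hd : ∀ x, HasDerivAt d (d' x) x) (hd' : DifferentiableAt ℝ d' p) (h0 : d p = 0)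
    (h0' : d' p = 0) (hw : HasDerivAt w w' p) (hwp : w p = 0) (hw' : w' ≠ 0)
    (hN : ContinuousAt N p) (hNp : N p ≠ 0) :
    ContinuousAt (fun x => d x ^ 2 / (N x * ‖w x‖ ^ 3)) p := by
  obtain ⟨C, hC⟩ := eventually_abs_le_mul_sq hd hd' h0 h0'
  have hv : ContinuousAt (dslope w p) p := by
    rw [continuousAt_dslope_same]; exact hw.differentiableAt
  have hvp : dslope w p p = w' := by rw [dslope_same, hw.deriv]
  have hvp0 : N p * ‖dslope w p p‖ ^ 3 ≠ 0 := by
    rw [hvp]; exact mul_ne_zero hNp (pow_ne_zero _ (norm_ne_zero_iff.2 hw'))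
  have hlim : Tendsto (fun x => C ^ 2 * |x - p| * |(N x * ‖dslope w p x‖ ^ 3)⁻¹|) (𝓝 p) (𝓝 0) := by
    have : ContinuousAt (fun x => C ^ 2 * |x - p| * |(N x * ‖dslope w p x‖ ^ 3)⁻¹|) p := by
      refine ContinuousAt.mul (by fun_prop) (ContinuousAt.abs ?_)
      exact (hN.mul (hv.norm.pow 3)).inv₀ hvp0
    simpa [ContinuousAt] using this
  rw [ContinuousAt]
  simp only [h0, hwp]
  norm_num
  refine squeeze_zero_norm' ?_ hlim
  filter_upwards [hC] with x hx
  rcases eq_or_ne x p with rfl | hxp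
  · simp [hwp]
  have hxp' : 0 < |x - p| := abs_pos.2 (sub_ne_zero.2 hxp)
  have hwx : w x = (x - p) • dslope w p x := by rw [sub_smul_dslope, hwp, sub_zero]
  rw [hwx, norm_smul, Real.norm_eq_abs, Real.norm_eq_abs, abs_div, abs_pow, div_eq_mul_inv]
  have e : |N x * (|x - p| * ‖dslope w p x‖) ^ 3|⁻¹ =
      (|x - p| ^ 3)⁻¹ * |(N x * ‖dslope w p x‖ ^ 3)⁻¹| := by
    rw [abs_inv, ← mul_inv, abs_mul, abs_mul, abs_of_nonneg (by positivity :
      0 ≤ (|x - p| * ‖dslope w p x‖) ^ 3), abs_of_nonneg (by positivity :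
      0 ≤ ‖dslope w p x‖ ^ 3)]
    congr 1; ring
  rw [e, ← mul_assoc]
  refine mul_le_mul_of_nonneg_right ?_ (abs_nonneg _)
  rw [← div_eq_mul_inv, div_le_iff₀ (by positivity)]
  calc |d x| ^ 2 ≤ (C * |x - p| ^ 2) ^ 2 := by gcongr
    _ = _ := by ring

end DissipationContinuity

/-! ### The jump formula for a closed curve -/

section Curve

variable {c : ℝ → E3}

/-- At a zero of w = c × c' the triple product d = ⟨w, c''⟩ vanishes to second order: since w' = c ×
c'' is orthogonal to c'', d' = ⟨w, c'''⟩ vanishes too. -/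
theorem continuousAt_dissipationDensity (hc : ContDiff ℝ ∞ c) (h0 : ∀ x, c x ≠ 0)
    (h1 : ∀ x, deriv c x ≠ 0) {x : ℝ}
    (hx : cross (c x) (deriv c x) ≠ 0 ∨ cross (c x) (deriv (deriv c) x) ≠ 0) :
    ContinuousAt (dissipationDensity c) x := by
  have hc1 := contDiff_deriv hc
  have hc2 := contDiff_deriv hc1
  have hc3 := contDiff_deriv hc2
  have hw : ContDiff ℝ ∞ (fun y => cross (c y) (deriv c y)) := hc.cross3 hc1
  have hn : ∀ y, ‖deriv c y‖ ^ 2 ≠ 0 := fun y => pow_ne_zero _ (norm_ne_zero_iff.2 (h1 y))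
  have e : dissipationDensity c = fun y =>
      inner ℝ (cross (c y) (deriv c y)) (deriv (deriv c) y) ^ 2 /
      (‖deriv c y‖ ^ 2 * ‖cross (c y) (deriv c y)‖ ^ 3) := by
    ext1 y; exact dissipationDensity_eq (h0 y) (h1 y)
  rw [e]
  have hnc : Continuous fun y => ‖deriv c y‖ ^ 2 := hc1.continuous.norm.pow 2
  by_cases hwx : cross (c x) (deriv c x) = 0
  · have hdd : ContDiff ℝ ∞ fun y =>
      inner ℝ (cross (c y) (deriv c y)) (deriv (deriv (deriv c)) y) := hw.inner ℝ hc3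
    refine continuousAt_sq_div_norm_cube
      (d := fun y => inner ℝ (cross (c y) (deriv c y)) (deriv (deriv c) y))
      (d' := fun y => inner ℝ (cross (c y) (deriv c y)) (deriv (deriv (deriv c)) y))
      (w := fun y => cross (c y) (deriv c y)) (N := fun y => ‖deriv c y‖ ^ 2)
      (fun y => ?_) (hdd.differentiable (by simp) x) ?_ ?_
      (hasDerivAt_cross_deriv hc x) hwx (hx.resolve_left (by simp [hwx])) hnc.continuousAt (hn x)
    · refine ((hasDerivAt_cross_deriv hc y).inner ℝ (hasDerivAt_of_contDiff hc2 y)).congr_deriv ?_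
      rw [inner_cross_right_self, add_zero]
    · simp [hwx]
    · simp [hwx]
  · refine ContinuousAt.div ?_ ?_ ?_
    · exact ((hw.continuous.inner hc2.continuous).pow 2).continuousAt
    · exact (hnc.mul (hw.continuous.norm.pow 3)).continuousAt
    · exact mul_ne_zero (hn x) (pow_ne_zero _ (norm_ne_zero_iff.2 hwx))

theorem periodic_deriv {T : ℝ} {f : ℝ → E3} (hf : Function.Periodic f T) :
    Function.Periodic (deriv f) T := by
  intro x
  rw [← deriv_comp_add_const]
  congr 1
  ext1 y; exact hf y

theorem continuous_crossRate (hc : ContDiff ℝ ∞ c) (h1 : ∀ x, deriv c x ≠ 0) :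
    Continuous (crossRate c) :=
  ((contDiff_curvatureVector hc h1).continuous.cross3 (contDiff_deriv hc).continuous).add
    (hc.continuous.cross3 (contDiff_deriv (contDiff_curvatureVector hc h1)).continuous)

/-- At a radial point c = λc' with λ = ⟨c, c'⟩/|c'|², hence c × c'' = λ c' × c''. This dictates the
choice of `fluxField`. -/
theorem cross_deriv_deriv_eq (h0 : ∀ x, c x ≠ 0) (h1 : ∀ x, deriv c x ≠ 0) {x : ℝ}
    (hx : cross (c x) (deriv c x) = 0) :
    cross (c x) (deriv (deriv c) x) = (‖c x‖ ^ 2 * ‖deriv c x‖ ^ 2) • fluxField c x := by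
  have hr := norm_pos_iff.2 (h0 x)
  have hn := norm_pos_iff.2 (h1 x)
  have h := cross_cross_right (deriv c x) (c x) (deriv c x)
  rw [hx, show cross (deriv c x) (0 : E3) = 0 by simp [cross], real_inner_self_eq_norm_sq,
    real_inner_comm, eq_comm, sub_eq_zero] at h
  have hcx : c x = (inner ℝ (c x) (deriv c x) / ‖deriv c x‖ ^ 2) • deriv c x := by
    rw [div_eq_inv_mul, mul_smul, ← h, smul_smul, inv_mul_cancel₀ (by positivity), one_smul]
  rw [fluxField, smul_smul]
  conv_lhs => rw [hcx, cross_smul_left]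
  congr 1
  field_simp

theorem jumpData_of_curve (hc : ContDiff ℝ ∞ c) (h0 : ∀ x, c x ≠ 0) (h1 : ∀ x, deriv c x ≠ 0)
    {T : ℝ} (hT : 0 < T) (hper : Function.Periodic c T) :
    JumpData T (fun x => cross (c x) (deriv c x)) (fun x => cross (c x) (deriv (deriv c) x))
      (fluxField c) (deriv (fluxField c)) (fun x => ‖c x‖ ^ 2 * ‖deriv c x‖ ^ 2)
      (dissipationDensity c) (densityRate c)
      (fun x => ‖crossRate c x‖ / ‖c x‖ ^ 2 +
        |2 * inner ℝ (c x) (curvatureVector c x) * ‖cross (c x) (deriv c x)‖ / (‖c x‖ ^ 2) ^ 2|) := by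
  have hc1 := contDiff_deriv hc
  have hc2 := contDiff_deriv hc1
  have hB := contDiff_fluxField hc h0 h1
  have hV := contDiff_curvatureVector hc h1
  have hw := hc.continuous.cross3 hc1.continuous
  have hY := continuous_crossRate hc h1
  have hn2 : Continuous fun x => ‖c x‖ ^ 2 := hc.continuous.norm.pow 2
  have hn2' : ∀ x, ‖c x‖ ^ 2 ≠ 0 := fun y => pow_ne_zero _ (norm_ne_zero_iff.2 (h0 y))
  have hlast : Continuous fun x => 2 * inner ℝ (c x) (curvatureVector c x) *
      ‖cross (c x) (deriv c x)‖ / (‖c x‖ ^ 2) ^ 2 :=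
    ((continuous_const.mul (hc.continuous.inner hV.continuous)).mul hw.norm).div (hn2.pow 2)
      fun x => pow_ne_zero _ (hn2' x)
  have hper1 := periodic_deriv hper
  have hper2 := periodic_deriv hper1
  refine
    { T_pos := hT
      hasDerivAt_w := hasDerivAt_cross_deriv hc
      hasDerivAt_B := hasDerivAt_of_contDiff hB
      continuous_w' := hc.continuous.cross3 hc2.continuous
      continuous_B' := (contDiff_deriv hB).continuous
      periodic_w := fun x => by simp only [hper x, hper1 x]
      periodic_B := fun x => by simp only [fluxField, hper x, hper1 x, hper2 x]
      deriv_eq := fun x hx => cross_deriv_deriv_eq h0 h1 hx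
      mu_pos := fun x _ => ?_
      D_nonneg := fun x => ?_
      D_zero := fun x hx => ?_
      continuousAt_D := fun x hx => ?_
      measurable_g := ?_
      abs_g_le := fun x => ?_
      continuous_G := ?_
      g_zero := fun x hx => ?_
      hasDerivAt_F := fun x hx => hasDerivAt_flux hc h0 h1 hx }
  · have := norm_pos_iff.2 (h0 x); have := norm_pos_iff.2 (h1 x); positivity
  · rw [dissipationDensity_eq (h0 x) (h1 x)]; positivity
  · rw [dissipationDensity_eq (h0 x) (h1 x), hx]; simp
  · by_cases hwx : cross (c x) (deriv c x) = 0
    · refine continuousAt_dissipationDensity hc h0 h1 (Or.inr ?_)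
      rw [cross_deriv_deriv_eq h0 h1 hwx]
      exact smul_ne_zero (mul_ne_zero (hn2' x) (pow_ne_zero _ (norm_ne_zero_iff.2 (h1 x))))
        (hx.resolve_left (by simp [hwx]))
    · exact continuousAt_dissipationDensity hc h0 h1 (Or.inl hwx)
  · exact ((hw.inner hY).measurable.div (hw.norm.mul hn2).measurable).sub hlast.measurable
  · refine (abs_sub _ _).trans (add_le_add_left ?_ _)
    have hr : 0 < ‖c x‖ ^ 2 := (sq_nonneg _).lt_of_ne' (hn2' x)
    rw [← div_div, abs_div, abs_of_pos hr]
    refine div_le_div_of_nonneg_right ?_ hr.le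
    rw [abs_div, abs_norm]
    refine div_le_of_le_mul₀ (norm_nonneg _) (norm_nonneg _) ?_
    rw [mul_comm]; exact abs_real_inner_le_norm _ _
  · exact (hY.norm.div hn2 hn2').add hlast.abs
  · have hx' : cross (c x) (deriv c x) = 0 := hx
    simp [densityRate, hx']

/-- At a radial point Cauchy–Schwarz is an equality, |⟨c, c'⟩| = |c||c'|; this identifies the jump
2|B| with 2κ/|c|. -/
theorem norm_fluxField {x : ℝ} (h0 : c x ≠ 0) (h1 : deriv c x ≠ 0)
    (hx : cross (c x) (deriv c x) = 0) : ‖fluxField c x‖ = curvature c x / ‖c x‖ := by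
  have hr := norm_pos_iff.2 h0
  have hn := norm_pos_iff.2 h1
  have h := norm_sq_cross (c x) (deriv c x)
  rw [hx, norm_zero] at h
  have hp : |inner ℝ (c x) (deriv c x)| = ‖c x‖ * ‖deriv c x‖ := by
    rw [← abs_of_nonneg (by positivity : 0 ≤ ‖c x‖ * ‖deriv c x‖), ← sq_eq_sq_iff_abs_eq_abs]
    linarith
  have hk : ‖cross (deriv c x) (deriv (deriv c) x)‖ = ‖cross (deriv (deriv c) x) (deriv c x)‖ := by
    refine (sq_eq_sq₀ (norm_nonneg _) (norm_nonneg _)).1 ?_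
    rw [norm_sq_cross, norm_sq_cross, real_inner_comm]; ring
  rw [fluxField, curvature, norm_smul, hk, norm_div, Real.norm_eq_abs, hp, Real.norm_eq_abs,
    abs_of_pos (by positivity)]
  field_simp

/-- Integral form of the first variation formula for the length of the radial projection. -/
theorem integral_densityRate (hc : ContDiff ℝ ∞ c) (h0 : ∀ x, c x ≠ 0) (h1 : ∀ x, deriv c x ≠ 0)
    (hper : Function.Periodic c (2 * π)) :
    IntervalIntegrable (dissipationDensity c) volume 0 (2 * π) ∧
    Summable (fun x : radialPoints c => curvature c x / ‖c x‖) ∧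
    ∫ x in 0..2 * π, densityRate c x = -(∫ x in 0..2 * π, dissipationDensity c x) -
      2 * ∑' x : radialPoints c, curvature c x / ‖c x‖ := by
  obtain ⟨i, s, e⟩ := (jumpData_of_curve hc h0 h1 two_pi_pos hper).integral_eq
  have hset : {x | x ∈ Ico 0 (2 * π) ∧ cross (c x) (deriv c x) = 0} = radialPoints c := by
    ext x
    exact and_congr_right fun _ => (psi_eq_iff (h0 x) (h1 x)).symm
  rw [hset] at s e
  have hfun : (fun x : radialPoints c => ‖fluxField c x‖) =
      fun x : radialPoints c => curvature c x / ‖c x‖ := by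
    ext1 x
    exact norm_fluxField (h0 x) (h1 x) ((psi_eq_iff (h0 x) (h1 x)).1 x.2.2)
  rw [hfun] at s e
  exact ⟨i, s, e⟩

end Curve

/-! ### Time derivative of the length of the radial projection -/

section Flow

/-- Zeros of w with w' ≠ 0 are isolated. Where w = w' = 0 the curvature vector V vanishes, so V' = 0
there off a countable set, and then V × c' + c × V' = 0. -/
theorem countable_setOf_crossRate_ne_zero {c : ℝ → E3} (hc : ContDiff ℝ ∞ c) (h0 : ∀ x, c x ≠ 0)
    (h1 : ∀ x, deriv c x ≠ 0) :
    {x | cross (c x) (deriv c x) = 0 ∧ crossRate c x ≠ 0}.Countable := by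
  have hV := contDiff_curvatureVector hc h1
  set S₁ : Set ℝ := {x | cross (c x) (deriv c x) = 0 ∧ cross (c x) (deriv (deriv c) x) = 0} with hS₁
  have hVz : ∀ x ∈ S₁, curvatureVector c x = 0 := by
    rintro x ⟨hx, hx'⟩
    have hr := norm_pos_iff.2 (h0 x)
    have hn := norm_pos_iff.2 (h1 x)
    rw [cross_deriv_deriv_eq h0 h1 hx, smul_eq_zero_iff_right (by positivity), ← norm_eq_zero,
      norm_fluxField (h0 x) (h1 x) hx, div_eq_zero_iff, or_iff_left hr.ne',
      ← norm_curvatureVector (h1 x), norm_eq_zero] at hx'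
    exact hx'
  have k1 := countable_setOf_eq_zero_of_deriv_ne_zero {x | cross (c x) (deriv c x) = 0}
    (hasDerivAt_cross_deriv hc) fun x hx => hx
  have k2 := countable_setOf_eq_zero_of_deriv_ne_zero S₁ (hasDerivAt_of_contDiff hV) hVz
  refine (k1.union k2).mono ?_
  rintro x ⟨hx, hx'⟩
  by_cases hw' : cross (c x) (deriv (deriv c) x) = 0
  · refine Or.inr ⟨⟨hx, hw'⟩, fun h => hx' ?_⟩
    rw [crossRate, hVz x ⟨hx, hw'⟩, h]
    simp [cross]
  · exact Or.inl ⟨hx, hw'⟩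

theorem hasDerivAt_norm_of_zero {E : Type*} [NormedAddCommGroup E] [NormedSpace ℝ E] {f : ℝ → E}
    {t : ℝ} (hf : HasDerivAt f 0 t) (h0 : f t = 0) : HasDerivAt (fun s => ‖f s‖) 0 t := by
  rw [hasDerivAt_iff_isLittleO] at hf ⊢
  simpa [h0] using hf

theorem hasDerivAt_norm_of_ne_zero {E : Type*} [NormedAddCommGroup E] [InnerProductSpace ℝ E]
    {f : ℝ → E} {f' : E} {t : ℝ} (hf : HasDerivAt f f' t) (h0 : f t ≠ 0) :
    HasDerivAt (fun s => ‖f s‖) (inner ℝ (f t) f' / ‖f t‖) t := by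
  have h := hf.norm_sq.sqrt (pow_ne_zero 2 (norm_ne_zero_iff.2 h0))
  simp only [Real.sqrt_sq (norm_nonneg _)] at h
  refine h.congr_deriv ?_
  rw [mul_div_mul_left _ _ two_ne_zero]

variable {J : Set ℝ} {γ : ℝ → ℝ → E3}

theorem IsRescaledCSF.isOpen_domain (hJ : IsOpen J) : IsOpen (J ×ˢ (univ : Set ℝ)) :=
  hJ.prod isOpen_univ

theorem IsRescaledCSF.contDiff (hγ : IsRescaledCSF J γ) {τ : ℝ} (hτ : τ ∈ J) :
    ContDiff ℝ ∞ (γ τ) := by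
  have h : ContDiff ℝ ∞ fun x : ℝ => ((τ, x) : ℝ × ℝ) := contDiff_const.prodMk contDiff_id
  exact contDiffOn_univ.1 (hγ.smooth.comp h.contDiffOn fun x _ => ⟨hτ, mem_univ _⟩)

theorem IsRescaledCSF.hasFDerivAt (hJ : IsOpen J) (hγ : IsRescaledCSF J γ) {τ : ℝ} (hτ : τ ∈ J)
    (x : ℝ) : HasFDerivAt (fun p : ℝ × ℝ => γ p.1 p.2)
      (fderiv ℝ (fun p : ℝ × ℝ => γ p.1 p.2) (τ, x)) (τ, x) :=
  ((hγ.smooth.contDiffAt ((IsRescaledCSF.isOpen_domain hJ).mem_nhds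
    ⟨hτ, mem_univ _⟩)).differentiableAt (by simp)).hasFDerivAt

theorem IsRescaledCSF.fderiv_space (hJ : IsOpen J) (hγ : IsRescaledCSF J γ) {τ : ℝ} (hτ : τ ∈ J)
    (x : ℝ) : fderiv ℝ (fun p : ℝ × ℝ => γ p.1 p.2) (τ, x) (0, 1) = deriv (γ τ) x := by
  have h := HasFDerivAt.comp_hasDerivAt x (f := fun x => ((τ, x) : ℝ × ℝ)) (hγ.hasFDerivAt hJ hτ x)
    ((hasDerivAt_const x τ).prodMk (hasDerivAt_id x))
  exact h.deriv.symm

theorem IsRescaledCSF.fderiv_time (hJ : IsOpen J) (hγ : IsRescaledCSF J γ) {τ : ℝ} (hτ : τ ∈ J)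
    (x : ℝ) : fderiv ℝ (fun p : ℝ × ℝ => γ p.1 p.2) (τ, x) (1, 0) =
      (1 / 2 : ℝ) • γ τ x + curvatureVector (γ τ) x := by
  have h := HasFDerivAt.comp_hasDerivAt τ (f := fun s => ((s, x) : ℝ × ℝ)) (hγ.hasFDerivAt hJ hτ x)
    ((hasDerivAt_id τ).prodMk (hasDerivAt_const τ x))
  exact h.unique (hγ.flow τ hτ x)

theorem IsRescaledCSF.contDiffOn_fderiv (hJ : IsOpen J) (hγ : IsRescaledCSF J γ) :
    ContDiffOn ℝ ∞ (fderiv ℝ (fun p : ℝ × ℝ => γ p.1 p.2)) (J ×ˢ univ) :=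
  hγ.smooth.fderiv_of_isOpen (IsRescaledCSF.isOpen_domain hJ) le_rfl

/-- The tangent vector evolves by the spatial derivative of the velocity. -/
theorem IsRescaledCSF.hasDerivAt_deriv (hJ : IsOpen J) (hγ : IsRescaledCSF J γ) {τ : ℝ}
    (hτ : τ ∈ J) (x : ℝ) : HasDerivAt (fun s => deriv (γ s) x)
      ((1 / 2 : ℝ) • deriv (γ τ) x + deriv (curvatureVector (γ τ)) x) τ := by
  set Γ : ℝ × ℝ → E3 := fun p => γ p.1 p.2 with hΓ
  have hmem : J ×ˢ (univ : Set ℝ) ∈ 𝓝 (τ, x) :=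
    (IsRescaledCSF.isOpen_domain hJ).mem_nhds ⟨hτ, mem_univ _⟩
  have hd : HasFDerivAt (fderiv ℝ Γ) (fderiv ℝ (fderiv ℝ Γ) (τ, x)) (τ, x) :=
    (((hγ.contDiffOn_fderiv hJ).contDiffAt hmem).differentiableAt (by simp)).hasFDerivAt
  -- Symmetry of the second derivative turns the time derivative of the tangent into the space
  -- derivative of the velocity.
  have hsymm : IsSymmSndFDerivAt ℝ Γ (τ, x) :=
    (hγ.smooth.contDiffAt hmem).isSymmSndFDerivAt (by
      rw [minSmoothness_of_isRCLikeNormedField]; exact WithTop.coe_le_coe.2 (le_top : (2 : ℕ∞) ≤ ⊤))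
  have ht := (HasFDerivAt.comp_hasDerivAt τ (f := fun s => ((s, x) : ℝ × ℝ)) hd
    ((hasDerivAt_id τ).prodMk (hasDerivAt_const τ x))).clm_apply (hasDerivAt_const τ ((0, 1) : ℝ × ℝ))
  have hx := (HasFDerivAt.comp_hasDerivAt x (f := fun y => ((τ, y) : ℝ × ℝ)) hd
    ((hasDerivAt_const x τ).prodMk (hasDerivAt_id x))).clm_apply (hasDerivAt_const x ((1, 0) : ℝ × ℝ))
  have hc := hγ.contDiff hτ
  have hV := contDiff_curvatureVector hc (hγ.immersed τ hτ)
  have hx' : HasDerivAt (fun y => fderiv ℝ Γ (τ, y) (1, 0))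
      ((1 / 2 : ℝ) • deriv (γ τ) x + deriv (curvatureVector (γ τ)) x) x := by
    have e : (fun y => fderiv ℝ Γ (τ, y) (1, 0)) =
        fun y => (1 / 2 : ℝ) • γ τ y + curvatureVector (γ τ) y := by
      ext1 y; exact hγ.fderiv_time hJ hτ y
    rw [e]
    exact ((hasDerivAt_of_contDiff hc x).fun_const_smul _).fun_add (hasDerivAt_of_contDiff hV x)
  have key := hx.unique hx'
  simp only [map_zero, add_zero] at key ht
  rw [hsymm.eq, key] at ht
  refine ht.congr_of_eventuallyEq ?_
  filter_upwards [hJ.mem_nhds hτ] with s hs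
  exact (hγ.fderiv_space hJ hs x).symm

/-- The vector `c × c' / |c|²`, whose norm is the density of the length of the radial
projection. -/
noncomputable def sphereVelocity (γ : ℝ → ℝ → E3) (p : ℝ × ℝ) : E3 :=
  (‖γ p.1 p.2‖ ^ 2)⁻¹ • cross (γ p.1 p.2) (deriv (γ p.1) p.2)

theorem IsRescaledCSF.contDiffOn_sphereVelocity (hJ : IsOpen J) (hγ : IsRescaledCSF J γ) :
    ContDiffOn ℝ ∞ (sphereVelocity γ) {p | p ∈ J ×ˢ (univ : Set ℝ) ∧ γ p.1 p.2 ≠ 0} := by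
  have hs := hγ.smooth.mono (s := J ×ˢ univ)
    (t := {p | p ∈ J ×ˢ (univ : Set ℝ) ∧ γ p.1 p.2 ≠ 0}) fun p hp => hp.1
  have hd : ContDiffOn ℝ ∞ (fun p : ℝ × ℝ => deriv (γ p.1) p.2)
      {p | p ∈ J ×ˢ (univ : Set ℝ) ∧ γ p.1 p.2 ≠ 0} := by
    refine (((hγ.contDiffOn_fderiv hJ).mono fun p hp => hp.1).clm_apply
      (contDiffOn_const (c := ((0, 1) : ℝ × ℝ)))).congr fun p hp => ?_
    exact (hγ.fderiv_space hJ hp.1.1 p.2).symm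
  refine ContDiffOn.smul (ContDiffOn.inv (hs.norm_sq ℝ) fun p hp => ?_) (hs.cross3 hd)
  exact pow_ne_zero _ (norm_ne_zero_iff.2 hp.2)

theorem IsRescaledCSF.isOpen_ne_zero (hJ : IsOpen J) (hγ : IsRescaledCSF J γ) :
    IsOpen {p : ℝ × ℝ | p ∈ J ×ˢ (univ : Set ℝ) ∧ γ p.1 p.2 ≠ 0} :=
  hγ.smooth.continuousOn.isOpen_inter_preimage (IsRescaledCSF.isOpen_domain hJ)
    isOpen_compl_singleton

/-- The term ½γ disappears: γ × γ' / |γ|² is invariant under rescaling of γ. -/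
theorem IsRescaledCSF.hasDerivAt_sphereVelocity (hJ : IsOpen J) (hγ : IsRescaledCSF J γ) {τ : ℝ}
    (hτ : τ ∈ J) {x : ℝ} (h0 : γ τ x ≠ 0) :
    HasDerivAt (fun s => sphereVelocity γ (s, x))
      ((‖γ τ x‖ ^ 2)⁻¹ • crossRate (γ τ) x -
        (2 * inner ℝ (γ τ x) (curvatureVector (γ τ) x) / (‖γ τ x‖ ^ 2) ^ 2) •
          cross (γ τ x) (deriv (γ τ) x)) τ := by
  have hr := norm_pos_iff.2 h0
  have d1 := hγ.flow τ hτ x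
  have d2 := hγ.hasDerivAt_deriv hJ hτ x
  have dn : HasDerivAt (fun s => (‖γ s x‖ ^ 2)⁻¹) _ τ := d1.norm_sq.inv (by positivity)
  refine (dn.smul (d1.cross3 d2)).congr_deriv ?_
  rw [inner_add_right, inner_smul_right, real_inner_self_eq_norm_sq, crossRate]
  simp only [cross_add_left, cross_add_right, cross_smul_left, cross_smul_right]
  match_scalars
  all_goals field_simp
  all_goals ring

theorem IsRescaledCSF.sphereLengthDensity_eq_norm (hγ : IsRescaledCSF J γ) {s x : ℝ}
    (hs : s ∈ J) (h0 : γ s x ≠ 0) : sphereLengthDensity (γ s) x = ‖sphereVelocity γ (s, x)‖ :=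
  sphereLengthDensity_eq h0 (hγ.immersed s hs x)

/-- A norm is differentiable at a zero of its argument if the argument has zero velocity; `hx`
ensures this at radial points, where the rate is then 0. -/
theorem IsRescaledCSF.hasDerivAt_density (hJ : IsOpen J) (hγ : IsRescaledCSF J γ) {τ : ℝ}
    (hτ : τ ∈ J) {x : ℝ} (h0 : γ τ x ≠ 0)
    (hx : cross (γ τ x) (deriv (γ τ) x) = 0 → crossRate (γ τ) x = 0) :
    HasDerivAt (fun s => ‖sphereVelocity γ (s, x)‖) (densityRate (γ τ) x) τ := by
  have hr := norm_pos_iff.2 h0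
  have d := hγ.hasDerivAt_sphereVelocity hJ hτ h0
  by_cases hw : cross (γ τ x) (deriv (γ τ) x) = 0
  · rw [hw, hx hw, smul_zero, smul_zero, sub_zero] at d
    refine (hasDerivAt_norm_of_zero d (by simp [sphereVelocity, hw])).congr_deriv ?_
    simp [densityRate, hw]
  · have hne : sphereVelocity γ (τ, x) ≠ 0 := smul_ne_zero (by positivity) hw
    refine (hasDerivAt_norm_of_ne_zero d hne).congr_deriv ?_
    have hW := norm_pos_iff.2 hw
    rw [densityRate, sphereVelocity]
    simp only [inner_smul_left, inner_sub_right, inner_smul_right, norm_smul,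
      real_inner_self_eq_norm_sq, norm_inv, norm_pow, norm_norm, conj_trivial]
    field_simp

theorem IsRescaledCSF.hasDerivAt_integral (hJ : IsOpen J) (hγ : IsRescaledCSF J γ) {τ : ℝ}
    (hτ : τ ∈ J) (h0 : ∀ x, γ τ x ≠ 0) :
    IntervalIntegrable (sphereLengthDensity (γ τ)) volume 0 (2 * π) ∧
    HasDerivAt (fun s => ∫ x in (0 : ℝ)..(2 * π), sphereLengthDensity (γ s) x)
      (∫ x in (0 : ℝ)..(2 * π), densityRate (γ τ) x) τ := by
  have hc := hγ.contDiff hτ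
  have h1 := hγ.immersed τ hτ
  set Ω : Set (ℝ × ℝ) := {p | p ∈ J ×ˢ (univ : Set ℝ) ∧ γ p.1 p.2 ≠ 0} with hΩ
  have hΩo : IsOpen Ω := hγ.isOpen_ne_zero hJ
  have hy := hγ.contDiffOn_sphereVelocity hJ
  -- By compactness of a period, the curves at times near τ also avoid the origin, uniformly in x.
  obtain ⟨u, v, hu, -, hτu, hIv, huv⟩ := generalized_tube_lemma (s := {τ}) isCompact_singleton
    (t := Icc 0 (2 * π)) isCompact_Icc hΩo (by
      rintro ⟨s, x⟩ ⟨hs, -⟩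
      obtain rfl : s = τ := hs
      exact ⟨⟨hτ, mem_univ _⟩, h0 x⟩)
  obtain ⟨ε, hε, hball⟩ := Metric.nhds_basis_closedBall.mem_iff.1
    (hu.mem_nhds (hτu (mem_singleton τ)))
  have hsub : Metric.closedBall τ ε ×ˢ Icc 0 (2 * π) ⊆ Ω := fun p hp =>
    huv ⟨hball hp.1, hIv hp.2⟩
  have hfd : ContinuousOn (fderiv ℝ (sphereVelocity γ)) Ω :=
    (hy.fderiv_of_isOpen hΩo (m := ∞) le_rfl).continuousOn
  obtain ⟨K, hK⟩ := ((isCompact_closedBall τ ε).prod isCompact_Icc).exists_bound_of_continuousOn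
    ((hfd.clm_apply (continuousOn_const (c := ((1, 0) : ℝ × ℝ)))).mono hsub)
  have hyc : ∀ s ∈ Metric.closedBall τ ε,
      ContinuousOn (fun x => sphereVelocity γ (s, x)) (Icc 0 (2 * π)) := fun s hs =>
    hy.continuousOn.comp (by fun_prop) fun x hx => hsub ⟨hs, hx⟩
  have hρ : ∀ s ∈ Metric.closedBall τ ε, ∀ x ∈ Icc 0 (2 * π),
      sphereLengthDensity (γ s) x = ‖sphereVelocity γ (s, x)‖ := fun s hs x hx =>
    hγ.sphereLengthDensity_eq_norm (hsub (⟨hs, hx⟩ : (s, x) ∈ _ ×ˢ _)).1.1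
      (hsub (⟨hs, hx⟩ : (s, x) ∈ _ ×ˢ _)).2
  have hρc : ∀ s ∈ Metric.closedBall τ ε,
      ContinuousOn (sphereLengthDensity (γ s)) (Icc 0 (2 * π)) := fun s hs =>
    (hyc s hs).norm.congr (hρ s hs)
  have hτb : τ ∈ Metric.closedBall τ ε := Metric.mem_closedBall_self hε.le
  have hint : IntervalIntegrable (sphereLengthDensity (γ τ)) volume 0 (2 * π) :=
    ContinuousOn.intervalIntegrable (by rw [uIcc_of_le two_pi_pos.le]; exact hρc τ hτb)
  refine ⟨hint, ?_⟩
  have hsub' : uIoc 0 (2 * π) ⊆ Icc 0 (2 * π) := by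
    rw [uIoc_of_le two_pi_pos.le]; exact Ioc_subset_Icc_self
  have hcount := countable_setOf_crossRate_ne_zero hc h0 h1
  refine (intervalIntegral.hasDerivAt_integral_of_dominated_loc_of_lip
    (F := fun s x => sphereLengthDensity (γ s) x) (F' := densityRate (γ τ)) (bound := fun _ => K)
    (Metric.closedBall_mem_nhds τ hε) ?_ hint ?_ ?_ intervalIntegrable_const ?_).2
  · filter_upwards [Metric.closedBall_mem_nhds τ hε] with s hs
    exact ((hρc s hs).mono hsub').aestronglyMeasurable measurableSet_uIoc
  · exact (jumpData_of_curve hc h0 h1 two_pi_pos (hγ.periodic τ hτ)).measurable_g.aestronglyMeasurable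
  · refine Eventually.of_forall fun x hx => ?_
    have hx' := hsub' hx
    have hL : LipschitzOnWith (Real.nnabs K) (fun s => sphereVelocity γ (s, x))
        (Metric.closedBall τ ε) := by
      refine Convex.lipschitzOnWith_of_nnnorm_hasDerivWithin_le (convex_closedBall τ ε)
        (f' := fun s => fderiv ℝ (sphereVelocity γ) (s, x) (1, 0)) (fun s hs => ?_) fun s hs => ?_
      · have hd : HasFDerivAt (sphereVelocity γ) (fderiv ℝ (sphereVelocity γ) (s, x)) (s, x) :=
          ((hy.contDiffAt (hΩo.mem_nhds (hsub ⟨hs, hx'⟩))).differentiableAt (by simp)).hasFDerivAt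
        exact (HasFDerivAt.comp_hasDerivAt s (f := fun s => ((s, x) : ℝ × ℝ)) hd
          ((hasDerivAt_id s).prodMk (hasDerivAt_const s x))).hasDerivWithinAt
      · rw [← NNReal.coe_le_coe, coe_nnnorm, Real.coe_nnabs]
        exact (hK (s, x) ⟨hs, hx'⟩).trans (le_abs_self K)
    intro s hs t ht
    simp only [hρ s hs x hx', hρ t ht x hx']
    exact (lipschitzWith_one_norm.edist_le_mul _ _).trans (by simpa using hL hs ht)
  -- The points where pointwise differentiability in time can fail are countable, hence null.
  · filter_upwards [hcount.ae_notMem volume] with x hx hxI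
    have hx' := hsub' hxI
    refine (hγ.hasDerivAt_density hJ hτ (h0 x) fun hw => ?_).congr_of_eventuallyEq ?_
    · by_contra hne
      exact hx ⟨hw, hne⟩
    · filter_upwards [Metric.closedBall_mem_nhds τ hε] with s hs
      exact hρ s hs x hx'

end Flow

/-! ### Integrals of functions of the radius -/

section Radial

theorem sin_psi {c : ℝ → E3} (x : ℝ) :
    sin (psi c x) = inner ℝ (c x) (deriv c x) / (‖c x‖ * ‖deriv c x‖) := by
  have h := abs_real_inner_div_norm_mul_norm_le_one (c x) (deriv c x)
  exact sin_arcsin (abs_le.1 h).1 (abs_le.1 h).2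

/-- On a closed curve, the integral of a function of the radius against `d|c|` vanishes. -/
theorem integral_radial {c : ℝ → E3} (hc : ContDiff ℝ ∞ c) (h1 : ∀ x, deriv c x ≠ 0) {T : ℝ}
    (hper : Function.Periodic c T) {a : ℝ → ℝ} (ha : ContinuousOn a (Ici 0)) :
    IntervalIntegrable (fun x => a ‖c x‖ * ‖deriv c x‖ * sin (psi c x)) volume 0 T ∧
      ∫ x in (0 : ℝ)..T, a ‖c x‖ * ‖deriv c x‖ * sin (psi c x) = 0 := by
  -- Continuous extension of a to the whole line, so that a primitive exists on both sides of 0.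
  set b : ℝ → ℝ := fun t => a (max t 0) with hb
  have hbc : Continuous b := ha.comp_continuous (by fun_prop) fun t => le_max_right t 0
  have hba : ∀ x, a ‖c x‖ = b ‖c x‖ := fun x => by simp [hb]
  have e : (fun x => a ‖c x‖ * ‖deriv c x‖ * sin (psi c x)) =
      fun x => b ‖c x‖ * (inner ℝ (c x) (deriv c x) / ‖c x‖) := by
    ext1 x
    have hn := norm_pos_iff.2 (h1 x)
    rw [sin_psi, hba, ← div_div]
    field_simp
  have hcc := hc.continuous
  have hc1 := (contDiff_deriv hc).continuous
  have hint : IntervalIntegrable (fun x => b ‖c x‖ * (inner ℝ (c x) (deriv c x) / ‖c x‖))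
      volume 0 T := by
    refine intervalIntegrable_of_le_continuous (G := fun x => |b ‖c x‖| * ‖deriv c x‖)
      ((hbc.comp hcc.norm).measurable.mul ((hcc.inner hc1).measurable.div hcc.norm.measurable))
      ((hbc.comp hcc.norm).abs.mul hc1.norm) (fun x => ?_) _ _
    change |b ‖c x‖ * (inner ℝ (c x) (deriv c x) / ‖c x‖)| ≤ _
    rw [abs_mul, abs_div, abs_norm]
    refine mul_le_mul_of_nonneg_left ?_ (abs_nonneg _)
    refine div_le_of_le_mul₀ (norm_nonneg _) (norm_nonneg _) ?_
    rw [mul_comm]; exact abs_real_inner_le_norm _ _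
  rw [e]
  refine ⟨hint, ?_⟩
  -- The curve is immersed, so its passages through the origin are isolated; only there may |c| fail
  -- to be differentiable.
  have hcount : {x | c x = 0}.Countable := by
    refine (countable_setOf_eq_zero_of_deriv_ne_zero {x | c x = 0}
      (hasDerivAt_of_contDiff hc) fun x hx => hx).mono ?_
    exact fun x hx => ⟨hx, h1 x⟩
  set A : ℝ → ℝ := fun t => ∫ u in (0 : ℝ)..t, b u with hA
  have hAd : ∀ t, HasDerivAt A (b t) t := fun t =>
    intervalIntegral.integral_hasDerivAt_right (hbc.intervalIntegrable _ _)
      (hbc.stronglyMeasurableAtFilter _ _) hbc.continuousAt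
  have hAc : Continuous A := continuous_iff_continuousAt.2 fun t => (hAd t).continuousAt
  rw [integral_eq_of_hasDerivAt_off_countable (fun x => A ‖c x‖) _ hcount
    (hAc.comp hcc.norm).continuousOn (fun x hx => ?_) hint]
  · have := hper 0
    rw [zero_add] at this
    rw [this, sub_self]
  · exact HasDerivAt.comp x (hAd ‖c x‖)
      (hasDerivAt_norm_of_ne_zero (hasDerivAt_of_contDiff hc x) hx.2)

end Radial

theorem theorem2 (J : Set ℝ) (hJ : IsOpen J) (γ : ℝ → ℝ → E3) (hγ : IsRescaledCSF J γ) :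
    (∀ τ ∈ J, (∀ x, γ τ x ≠ 0) →
      IntervalIntegrable (sphereLengthDensity (γ τ)) MeasureTheory.volume 0 (2 * π) ∧
      IntervalIntegrable (dissipationDensity (γ τ)) MeasureTheory.volume 0 (2 * π) ∧
      Summable (fun x : radialPoints (γ τ) => curvature (γ τ) x / ‖γ τ x‖) ∧
      HasDerivAt (fun s => ∫ x in (0 : ℝ)..(2 * π), sphereLengthDensity (γ s) x)
        (-(∫ x in (0 : ℝ)..(2 * π), dissipationDensity (γ τ) x)
          - 2 * ∑' x : radialPoints (γ τ), curvature (γ τ) x / ‖γ τ x‖) τ) ∧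
    (∀ a : ℝ → ℝ, ContinuousOn a (Ici 0) → ∀ τ ∈ J,
      IntervalIntegrable (fun x => a ‖γ τ x‖ * ‖deriv (γ τ) x‖ * sin (psi (γ τ) x))
        MeasureTheory.volume 0 (2 * π) ∧
      ∫ x in (0 : ℝ)..(2 * π), a ‖γ τ x‖ * ‖deriv (γ τ) x‖ * sin (psi (γ τ) x) = 0) := by
  refine ⟨fun τ hτ h0 => ?_, fun a ha τ hτ => ?_⟩
  · obtain ⟨hi, hd⟩ := hγ.hasDerivAt_integral hJ hτ h0
    obtain ⟨hD, hs, he⟩ := integral_densityRate (hγ.contDiff hτ) h0 (hγ.immersed τ hτ)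
      (hγ.periodic τ hτ)
    exact ⟨hi, hD, hs, he ▸ hd⟩
  · exact integral_radial (hγ.contDiff hτ) (hγ.immersed τ hτ) (hγ.periodic τ hτ) ha
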